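/- Let $p>1$, $a,b\in\mathbb{R}$, $R>1$, and let $f\in C^2(\mathbb{R})$, $g\in C^1(\mathbb{R})$ satisfy $\operatorname{supp} f,\ \operatorname{supp} g\subset\{x\in\mathbb{R}: |x|\le R\}$ and $\int_{\mathbb{R}}g(x)\,dx=0$. Write $\langle x\rangle=(1+x^2)^{1/2}$, and for $\varepsilon>0$ consider the Cauchy problem $$u_{tt}-u_{xx}=\langle t+\langle x\rangle\rangle^{-(1+a)}\langle t-\langle x\rangle\rangle^{-(1+b)}|u|^p,\qquad u(x,0)=\varepsilon f(x),\quad u_t(x,0)=\varepsilon g(x)\quad (x\in\mathbb{R}).$$ Let $\psi_1(s)=s^{-pa}\log(2+s)$ and $\psi_2(s)=s^{-b}(\log(2+s))^{p-1}$ for $s\ge0$, and let $\psi_1^{-1}$ (for $a<0$) and $\psi_2^{-1}$ (for $b<0$) be their inverse functions $[0,\infty)\to[0,\infty)$. Then there exist constants $\varepsilon_3>0$ and $c>0$, depending only on $f,g,p,a,b,R$ (in particular, $c$ is independent of $\varepsilon$), such that for all $0<\varepsilon\le\varepsilon_3$ the Cauchy problem has a unique classical solution $u\in C^2(\mathbb{R}\times[0,T))$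 for every $T>0$ with $$T\le\begin{cases} \exp(c\varepsilon^{-(p-1)}) & \text{if } a=0,\ b>0,\\ \exp(c\varepsilon^{-p(p-1)}) & \text{if } a+b=0,\ a>0,\\ \exp(c\varepsilon^{-p(p-1)/(p+1)}) & \text{if } a=b=0,\\ c\varepsilon^{-(p-1)/(-a)} & \text{if } a<0,\ b>0,\\ \psi_1^{-1}(c\varepsilon^{-p(p-1)}) & \text{if } a<0,\ b=0,\\ c\varepsilon^{-p(p-1)/(-pa-b)} & \text{if } a<0,\ b<0,\\ \psi_2^{-1}(c\varepsilon^{-p(p-1)}) & \text{if } a=0,\ b<0,\\ c\varepsilon^{-p(p-1)/(-a-b)} & \text{if } a+b<0,\ a>0. \end{cases}$$ (No claim is made for $a>0$, $a+b>0$.) -/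

import Mathlib

namespace CharWave

noncomputable section

/-- The bracket `⟨x⟩ = (1 + x²)^{1/2}`. -/
def bracket (x : ℝ) : ℝ := Real.sqrt (1 + x ^ 2)

/-- The characteristic weight `F(x,t) = ⟨t + ⟨x⟩⟩^{-(1+a)} ⟨t - ⟨x⟩⟩^{-(1+b)}`. -/
def weight (a b x t : ℝ) : ℝ :=
  bracket (t + bracket x) ^ (-(1 + a)) * bracket (t - bracket x) ^ (-(1 + b))

/-- `u` (a function of `x` and `t`) is a classical solution on `ℝ × [0,T)` of
`u_tt - u_xx = F(x,t) |u|^p` with `u(x,0) = ε f(x)`, `u_t(x,0) = ε g(x)`.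
Here `ContDiffOn ℝ 2` on `ℝ × [0,T)` is `C²` regularity up to `t = 0`; the time derivative at
`t = 0` is the one-sided one. -/
structure IsClassicalSolution (p a b ε : ℝ) (f g : ℝ → ℝ) (T : ℝ) (u : ℝ → ℝ → ℝ) : Prop where
  contDiffOn : ContDiffOn ℝ 2 (fun z : ℝ × ℝ => u z.1 z.2) (Set.univ ×ˢ Set.Ico 0 T)
  equation : ∀ x : ℝ, ∀ t ∈ Set.Ioo 0 T,
    iteratedDeriv 2 (fun s => u x s) t - iteratedDeriv 2 (fun y => u y t) x
      = weight a b x t * |u x t| ^ p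
  initial : ∀ x : ℝ, u x 0 = ε * f x
  initial_deriv : ∀ x : ℝ, HasDerivWithinAt (fun s => u x s) (ε * g x) (Set.Ici 0) 0

/-- `ψ₁(s) = s^{-pa} log(2 + s)`. -/
def psi1 (p a s : ℝ) : ℝ := s ^ (-(p * a)) * Real.log (2 + s)

/-- `ψ₂(s) = s^{-b} log^{p-1}(2 + s)`. -/
def psi2 (p b s : ℝ) : ℝ := s ^ (-b) * Real.log (2 + s) ^ (p - 1)

/-- The inverse of `ψ₁ : [0,∞) → [0,∞)`, a bijection when `p > 0` and `a < 0`
(see `psi1_bijOn`). -/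
def psi1Inv (p a : ℝ) : ℝ → ℝ := Function.invFunOn (psi1 p a) (Set.Ici 0)

/-- The inverse of `ψ₂ : [0,∞) → [0,∞)`, a bijection when `p ≥ 1` and `b < 0`
(see `psi2_bijOn`). -/
def psi2Inv (p b : ℝ) : ℝ → ℝ := Function.invFunOn (psi2 p b) (Set.Ici 0)

theorem rpow_mul_log_bijOn {q r : ℝ} (hq : 0 < q) (hr : 0 ≤ r) :
    Set.BijOn (fun s : ℝ => s ^ q * Real.log (2 + s) ^ r) (Set.Ici 0) (Set.Ici 0) := by
  have hlog : ∀ s : ℝ, 0 ≤ s → 0 < Real.log (2 + s) := fun s hs =>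
    Real.log_pos (by linarith)
  refine ⟨?_, ?_, ?_⟩
  · intro s hs
    exact mul_nonneg (Real.rpow_nonneg hs _) (Real.rpow_nonneg (hlog s hs).le _)
  · apply StrictMonoOn.injOn
    intro s hs t ht hst
    have hs' : (0 : ℝ) ≤ s := hs
    have ht' : (0 : ℝ) ≤ t := ht
    have h1 : s ^ q < t ^ q := Real.rpow_lt_rpow hs' hst hq
    have h2 : Real.log (2 + s) ^ r ≤ Real.log (2 + t) ^ r :=
      Real.rpow_le_rpow (hlog s hs').le
        (Real.log_le_log (by linarith) (by linarith)) hr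
    exact mul_lt_mul h1 h2 (Real.rpow_pos_of_pos (hlog s hs') _) (Real.rpow_nonneg ht' _)
  · intro y hy
    have hy' : (0 : ℝ) ≤ y := hy
    have hk : 0 < Real.log (2 + 0) ^ r := Real.rpow_pos_of_pos (hlog 0 le_rfl) _
    obtain ⟨M, hM0, hM⟩ : ∃ M : ℝ, 0 ≤ M ∧ y / Real.log (2 + 0) ^ r ≤ M ^ q :=
      ((Filter.eventually_ge_atTop (0 : ℝ)).and
        ((tendsto_rpow_atTop hq).eventually_ge_atTop _)).exists
    have hcont : ContinuousOn (fun s : ℝ => s ^ q * Real.log (2 + s) ^ r) (Set.Icc 0 M) := by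
      apply ContinuousOn.mul
      · exact continuousOn_id.rpow_const (fun _ _ => Or.inr hq.le)
      · apply ContinuousOn.rpow_const _ (fun _ _ => Or.inr hr)
        apply ContinuousOn.log (by fun_prop)
        intro s hs
        have := hs.1
        linarith
    have hle : y ≤ M ^ q * Real.log (2 + M) ^ r := by
      rw [div_le_iff₀ hk] at hM
      refine hM.trans (mul_le_mul_of_nonneg_left ?_ (Real.rpow_nonneg hM0 _))
      exact Real.rpow_le_rpow (hlog 0 le_rfl).le
        (Real.log_le_log (by norm_num) (by linarith)) hr
    have h0 : (0 : ℝ) ^ q * Real.log (2 + 0) ^ r ≤ y := by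
      rw [Real.zero_rpow hq.ne', zero_mul]; exact hy'
    obtain ⟨s, hs, hsy⟩ := intermediate_value_Icc hM0 hcont ⟨h0, hle⟩
    exact ⟨s, hs.1, hsy⟩

theorem psi1_bijOn {p a : ℝ} (hp : 0 < p) (ha : a < 0) :
    Set.BijOn (psi1 p a) (Set.Ici 0) (Set.Ici 0) := by
  have h := rpow_mul_log_bijOn (q := -(p * a)) (r := 1) (by nlinarith) zero_le_one
  simp only [Real.rpow_one] at h
  exact h

theorem psi2_bijOn {p b : ℝ} (hp : 1 ≤ p) (hb : b < 0) :
    Set.BijOn (psi2 p b) (Set.Ici 0) (Set.Ici 0) :=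
  rpow_mul_log_bijOn (q := -b) (r := p - 1) (by linarith) (by linarith)

theorem psi1Inv_invOn {p a : ℝ} (hp : 0 < p) (ha : a < 0) :
    Set.InvOn (psi1Inv p a) (psi1 p a) (Set.Ici 0) (Set.Ici 0) :=
  (psi1_bijOn hp ha).invOn_invFunOn

theorem psi2Inv_invOn {p b : ℝ} (hp : 1 ≤ p) (hb : b < 0) :
    Set.InvOn (psi2Inv p b) (psi2 p b) (Set.Ici 0) (Set.Ici 0) :=
  (psi2_bijOn hp hb).invOn_invFunOn

/-- `T` does not exceed the lifespan bound (with constant `c`) of the case that the pair `(a,b)`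
belongs to. The eight cases are mutually exclusive, and they cover all pairs `(a,b)` except those
with `a > 0` and `a + b > 0`. -/
def BelowLifespanBound (p a b c ε T : ℝ) : Prop :=
  (a = 0 ∧ 0 < b ∧ T ≤ Real.exp (c * ε ^ (-(p - 1)))) ∨
  (a + b = 0 ∧ 0 < a ∧ T ≤ Real.exp (c * ε ^ (-(p * (p - 1))))) ∨
  (a = 0 ∧ b = 0 ∧ T ≤ Real.exp (c * ε ^ (-(p * (p - 1) / (p + 1))))) ∨
  (a < 0 ∧ 0 < b ∧ T ≤ c * ε ^ (-((p - 1) / (-a)))) ∨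
  (a < 0 ∧ b = 0 ∧ T ≤ psi1Inv p a (c * ε ^ (-(p * (p - 1))))) ∨
  (a < 0 ∧ b < 0 ∧ T ≤ c * ε ^ (-(p * (p - 1) / (-(p * a) - b)))) ∨
  (a = 0 ∧ b < 0 ∧ T ≤ psi2Inv p b (c * ε ^ (-(p * (p - 1))))) ∨
  (a + b < 0 ∧ 0 < a ∧ T ≤ c * ε ^ (-(p * (p - 1) / (-a - b))))

end

end CharWave

namespace CharWave

open Set Filter Topology MeasureTheory intervalIntegral

/-! ### Calculus in the plane -/

/-! Write `u = ε u₀ + v`, with `u₀` the free wave and `v` the Duhamel integral of `F |ε u₀ + v|^p`.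
Since `∫ g = 0`, the free wave lives in `|t - |x|| ≤ R` (`freeWave_eq_zero`), where `⟨t - ⟨x⟩⟩` is
bounded. Its contribution to the Duhamel integral is therefore only of order `ε^p E`, with `E =
powInt a T`. The part `v` fills the cone `|x| ≤ t + R`; if `|v| ≤ D` there, it contributes at most a
constant times `D^p I`, with `I = coneInt a b R T`. This is `exists_isDuhamelBound`.

With `D` equal to twice the bound for the free-wave term, the estimate closes once `ε^{p(p-1)}
E^{p-1} I` is below a fixed constant (`exists_amplitude`). Each of `E`, `I` is bounded by a power of
`1 + T`, a logarithm, their product or a constant, according to the signs of `a`, `b`, `a + b`;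
solving for `T` gives the eight lifespans (`exists_lifespan_small`).

No continuation argument is needed. The source is cut off in space-time and in the unknown, so that
it becomes bounded and Lipschitz, and Banach's theorem in a time-weighted sup norm gives a global
solution (`exists_duhamel_fixedPoint`). The bounds above define a closed set invariant under the
iteration, so the fixed point satisfies them, and on its range the cutoffs in the equation are
inactive (`exists_classicalSolution`).

Uniqueness (`IsClassicalSolution.unique`) integrates the difference of two solutions twice along
characteristics in a backward triangle, again with an exponential weight. -/

theorem hasFDerivAt_of_continuous_partials {w w₁ w₂ : ℝ × ℝ → ℝ}
    (h₁ : ∀ x t, HasDerivAt (fun y => w (y, t)) (w₁ (x, t)) x)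
    (h₂ : ∀ x t, HasDerivAt (fun s => w (x, s)) (w₂ (x, t)) t)
    (c₁ : Continuous w₁) (c₂ : Continuous w₂) (z : ℝ × ℝ) :
    HasFDerivAt w ((ContinuousLinearMap.toSpanSingleton ℝ (w₁ z)).coprod
      (ContinuousLinearMap.toSpanSingleton ℝ (w₂ z))) z := by
  have key := hasStrictFDerivAt_uncurry_coprod (𝕜 := ℝ) (u := z) (f := fun x t => w (x, t))
    (f₁ := fun x t => ContinuousLinearMap.toSpanSingleton ℝ (w₁ (x, t)))
    (f₂ := fun x t => ContinuousLinearMap.toSpanSingleton ℝ (w₂ (x, t)))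
    (Eventually.of_forall fun v => (h₁ v.1 v.2).hasFDerivAt)
    (Eventually.of_forall fun v => (h₂ v.1 v.2).hasFDerivAt)
    (ContinuousLinearMap.toSpanSingletonCLE.continuous.comp c₁).continuousAt
    (ContinuousLinearMap.toSpanSingletonCLE.continuous.comp c₂).continuousAt
  exact key.hasFDerivAt

theorem contDiff_succ_of_partials {n : ℕ} {w w₁ w₂ : ℝ × ℝ → ℝ}
    (h₁ : ∀ x t, HasDerivAt (fun y => w (y, t)) (w₁ (x, t)) x)
    (h₂ : ∀ x t, HasDerivAt (fun s => w (x, s)) (w₂ (x, t)) t)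
    (c₁ : ContDiff ℝ n w₁) (c₂ : ContDiff ℝ n w₂) : ContDiff ℝ (n + 1) w := by
  refine contDiff_succ_iff_hasFDerivAt.2
    ⟨_, ?_, hasFDerivAt_of_continuous_partials h₁ h₂ c₁.continuous c₂.continuous⟩
  have e : (fun z => (ContinuousLinearMap.toSpanSingleton ℝ (w₁ z)).coprod
      (ContinuousLinearMap.toSpanSingleton ℝ (w₂ z))) =
      fun z => w₁ z • ContinuousLinearMap.fst ℝ ℝ ℝ + w₂ z • ContinuousLinearMap.snd ℝ ℝ ℝ := by
    ext z <;> simp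
  rw [e]
  exact (c₁.smul contDiff_const).add (c₂.smul contDiff_const)

theorem hasDerivAt_comp_pair {w w₁ w₂ : ℝ × ℝ → ℝ}
    (h₁ : ∀ x t, HasDerivAt (fun y => w (y, t)) (w₁ (x, t)) x)
    (h₂ : ∀ x t, HasDerivAt (fun s => w (x, s)) (w₂ (x, t)) t)
    (c₁ : Continuous w₁) (c₂ : Continuous w₂) {α β : ℝ → ℝ} {α' β' r : ℝ}
    (hα : HasDerivAt α α' r) (hβ : HasDerivAt β β' r) :
    HasDerivAt (fun r => w (α r, β r)) (α' * w₁ (α r, β r) + β' * w₂ (α r, β r)) r := by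
  have := (hasFDerivAt_of_continuous_partials h₁ h₂ c₁ c₂ (α r, β r)).comp_hasDerivAt r
    (hα.prodMk hβ)
  simpa [Function.comp_def] using this

theorem hasDerivAt_integral_param {q r : ℝ × ℝ → ℝ} (hq : Continuous q) (hr : Continuous r)
    (h : ∀ z s, HasDerivAt (fun z => q (z, s)) (r (z, s)) z) (z t : ℝ) :
    HasDerivAt (fun z => ∫ s in (0 : ℝ)..t, q (z, s)) (∫ s in (0 : ℝ)..t, r (z, s)) z := by
  obtain ⟨C, hC⟩ := ((isCompact_closedBall z 1).prod (isCompact_uIcc (a := (0 : ℝ)) (b := t))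
    ).exists_bound_of_continuousOn hr.continuousOn
  refine (intervalIntegral.hasDerivAt_integral_of_dominated_loc_of_deriv_le (F := fun z s => q (z, s))
    (F' := fun z s => r (z, s)) (bound := fun _ => C)
    (Metric.closedBall_mem_nhds z one_pos) ?_ ?_ ?_ ?_ ?_ ?_).2
  · exact Eventually.of_forall fun x => (by fun_prop : Continuous fun s => q (x, s)).aestronglyMeasurable
  · exact (by fun_prop : Continuous fun s => q (z, s)).intervalIntegrable _ _
  · exact (by fun_prop : Continuous fun s => r (z, s)).aestronglyMeasurable
  · exact Eventually.of_forall fun s hs x hx => hC (x, s) ⟨hx, uIoc_subset_uIcc hs⟩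
  · exact intervalIntegrable_const
  · exact Eventually.of_forall fun s _ x _ => h x s

theorem continuous_integral_param {q : ℝ × ℝ → ℝ} (hq : Continuous q) :
    Continuous fun z : ℝ × ℝ => ∫ s in (0 : ℝ)..z.2, q (z.1, s) :=
  continuous_parametric_primitive_of_continuous (f := fun z s => q (z, s)) hq

/-! ### Integration along characteristics -/

/-- The solution of `v_t - σ v_x = h` with zero initial value. -/
noncomputable def transport (σ : ℝ) (h : ℝ × ℝ → ℝ) (z : ℝ × ℝ) : ℝ :=
  ∫ s in (0 : ℝ)..z.2, h (z.1 + σ * (z.2 - s), s)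

theorem transport_eq (σ : ℝ) (h : ℝ × ℝ → ℝ) (z : ℝ × ℝ) :
    transport σ h z = ∫ s in (0 : ℝ)..z.2, h ((z.1 + σ * z.2) - σ * s, s) := by
  simp only [transport]; congr 1; ext s; congr 2; ring

theorem continuous_transport {σ : ℝ} {h : ℝ × ℝ → ℝ} (hh : Continuous h) :
    Continuous (transport σ h) := by
  have c : Continuous fun z : ℝ × ℝ => ∫ s in (0 : ℝ)..z.2, h (z.1 - σ * s, s) :=
    continuous_integral_param (q := fun z => h (z.1 - σ * z.2, z.2)) (by fun_prop)
  have := c.comp (by fun_prop : Continuous fun z : ℝ × ℝ => (z.1 + σ * z.2, z.2))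
  refine this.congr fun z => ?_
  rw [transport_eq]; rfl

/-- In the variables `ξ = x + σ t` and `t`, the `ξ`-derivative passes under the integral and the
`t`-derivative is the endpoint value. Hence no `t`-derivative of `h` is needed. -/
theorem hasDerivAt_transport_comp {σ : ℝ} {h k : ℝ × ℝ → ℝ} (hh : Continuous h) (hk : Continuous k)
    (hd : ∀ x t, HasDerivAt (fun y => h (y, t)) (k (x, t)) x) {α β : ℝ → ℝ} {α' β' r : ℝ}
    (hα : HasDerivAt α α' r) (hβ : HasDerivAt β β' r) :
    HasDerivAt (fun r => transport σ h (α r, β r))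
      ((α' + σ * β') * transport σ k (α r, β r) + β' * h (α r, β r)) r := by
  have hd' : ∀ x t, HasDerivAt (fun y => h (y - σ * t, t)) (k (x - σ * t, t)) x := fun x t => by
    simpa [Function.comp_def] using (hd (x - σ * t) t).comp x ((hasDerivAt_id x).sub_const (σ * t))
  have h₁ := fun x t => hasDerivAt_integral_param (q := fun z => h (z.1 - σ * z.2, z.2))
    (r := fun z => k (z.1 - σ * z.2, z.2)) (by fun_prop) (by fun_prop) hd' x t
  have h₂ : ∀ x t, HasDerivAt (fun t => ∫ s in (0 : ℝ)..t, h (x - σ * s, s)) (h (x - σ * t, t)) t :=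
    fun x t => intervalIntegral.integral_hasDerivAt_right
      ((by fun_prop : Continuous fun s => h (x - σ * s, s)).intervalIntegrable _ _)
      ((by fun_prop : Continuous fun s => h (x - σ * s, s)).stronglyMeasurableAtFilter _ _)
      (by fun_prop : Continuous fun s => h (x - σ * s, s)).continuousAt
  have := hasDerivAt_comp_pair (w := fun z => ∫ s in (0 : ℝ)..z.2, h (z.1 - σ * s, s))
    (w₁ := fun z => ∫ s in (0 : ℝ)..z.2, k (z.1 - σ * s, s)) (w₂ := fun z => h (z.1 - σ * z.2, z.2))
    h₁ h₂ (continuous_integral_param (q := fun z => k (z.1 - σ * z.2, z.2)) (by fun_prop))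
    (by fun_prop) (hα.fun_add (hβ.const_mul σ)) hβ
  simp only [transport_eq]
  simpa using this

theorem hasDerivAt_transport_fst {σ : ℝ} {h k : ℝ × ℝ → ℝ} (hh : Continuous h) (hk : Continuous k)
    (hd : ∀ x t, HasDerivAt (fun y => h (y, t)) (k (x, t)) x) (x t : ℝ) :
    HasDerivAt (fun y => transport σ h (y, t)) (transport σ k (x, t)) x := by
  simpa using hasDerivAt_transport_comp (σ := σ) hh hk hd (hasDerivAt_id x) (hasDerivAt_const x t)

theorem hasDerivAt_transport_snd {σ : ℝ} {h k : ℝ × ℝ → ℝ} (hh : Continuous h) (hk : Continuous k)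
    (hd : ∀ x t, HasDerivAt (fun y => h (y, t)) (k (x, t)) x) (x t : ℝ) :
    HasDerivAt (fun s => transport σ h (x, s)) (σ * transport σ k (x, t) + h (x, t)) t := by
  simpa using hasDerivAt_transport_comp (σ := σ) hh hk hd (hasDerivAt_const t x) (hasDerivAt_id t)

/-! ### Duhamel's formula -/

/-- The solution of `v_tt - v_xx = h` with zero Cauchy data. -/
noncomputable def duhamel (h : ℝ × ℝ → ℝ) (z : ℝ × ℝ) : ℝ :=
  (1 / 2) * ∫ s in (0 : ℝ)..z.2, ∫ y in (z.1 - (z.2 - s))..(z.1 + (z.2 - s)), h (y, s)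

/-- The spatial primitive of `h`. -/
noncomputable def xPrim (h : ℝ × ℝ → ℝ) (z : ℝ × ℝ) : ℝ := ∫ y in (0 : ℝ)..z.1, h (y, z.2)

theorem continuous_xPrim {h : ℝ × ℝ → ℝ} (hh : Continuous h) : Continuous (xPrim h) :=
  (continuous_integral_param (q := fun z => h (z.2, z.1)) (by fun_prop)).comp continuous_swap

theorem hasDerivAt_xPrim {h : ℝ × ℝ → ℝ} (hh : Continuous h) (x t : ℝ) :
    HasDerivAt (fun y => xPrim h (y, t)) (h (x, t)) x :=
  intervalIntegral.integral_hasDerivAt_right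
    ((by fun_prop : Continuous fun y => h (y, t)).intervalIntegrable _ _)
    ((by fun_prop : Continuous fun y => h (y, t)).stronglyMeasurableAtFilter _ _)
    (by fun_prop : Continuous fun y => h (y, t)).continuousAt

/-- The inner integral is a difference of values of the primitive on the two characteristics through
`z`. As `∂ₓ (xPrim h) = h`, continuity of `h` is enough for first derivatives of the Duhamel
integral. -/
theorem duhamel_eq {h : ℝ × ℝ → ℝ} (hh : Continuous h) (z : ℝ × ℝ) :
    duhamel h z = (transport 1 (xPrim h) z - transport (-1) (xPrim h) z) / 2 := by
  have hc := continuous_xPrim hh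
  have i : ∀ a b s : ℝ, IntervalIntegrable (fun y => h (y, s)) volume a b := fun a b s =>
    (by fun_prop : Continuous fun y => h (y, s)).intervalIntegrable _ _
  rw [duhamel, transport, transport, ← intervalIntegral.integral_sub]
  · rw [one_div, div_eq_inv_mul]
    refine congrArg ((2 : ℝ)⁻¹ * ·) (intervalIntegral.integral_congr fun s _ => ?_)
    simp only [xPrim]
    rw [intervalIntegral.integral_interval_sub_left (i _ _ _) (i _ _ _)]
    congr 1 <;> ring
  · exact (by fun_prop : Continuous fun s => xPrim h (z.1 + 1 * (z.2 - s), s)).intervalIntegrable _ _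
  · exact (by fun_prop : Continuous fun s =>
      xPrim h (z.1 + (-1) * (z.2 - s), s)).intervalIntegrable _ _

theorem continuous_duhamel {h : ℝ × ℝ → ℝ} (hh : Continuous h) : Continuous (duhamel h) := by
  have hc := continuous_xPrim hh
  rw [funext (duhamel_eq hh)]
  have := continuous_transport (σ := 1) hc
  have := continuous_transport (σ := -1) hc
  fun_prop

theorem hasDerivAt_duhamel_fst {h : ℝ × ℝ → ℝ} (hh : Continuous h) (x t : ℝ) :
    HasDerivAt (fun y => duhamel h (y, t))
      ((transport 1 h (x, t) - transport (-1) h (x, t)) / 2) x := by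
  simp only [duhamel_eq hh]
  exact ((hasDerivAt_transport_fst (continuous_xPrim hh) hh (hasDerivAt_xPrim hh) x t).sub
    (hasDerivAt_transport_fst (continuous_xPrim hh) hh (hasDerivAt_xPrim hh) x t)).div_const 2

theorem hasDerivAt_duhamel_snd {h : ℝ × ℝ → ℝ} (hh : Continuous h) (x t : ℝ) :
    HasDerivAt (fun s => duhamel h (x, s))
      ((transport 1 h (x, t) + transport (-1) h (x, t)) / 2) t := by
  simp only [duhamel_eq hh]
  convert! ((hasDerivAt_transport_snd (σ := 1) (continuous_xPrim hh) hh (hasDerivAt_xPrim hh) x t).sub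
    (hasDerivAt_transport_snd (σ := -1) (continuous_xPrim hh) hh (hasDerivAt_xPrim hh) x t)).div_const 2
    using 1
  ring

theorem contDiff_one_duhamel {h : ℝ × ℝ → ℝ} (hh : Continuous h) : ContDiff ℝ 1 (duhamel h) := by
  have c₁ := continuous_transport (σ := 1) hh
  have c₂ := continuous_transport (σ := -1) hh
  exact contDiff_succ_of_partials (n := 0)
    (w₁ := fun z => (transport 1 h z - transport (-1) h z) / 2)
    (w₂ := fun z => (transport 1 h z + transport (-1) h z) / 2)
    (hasDerivAt_duhamel_fst hh) (hasDerivAt_duhamel_snd hh)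
    (contDiff_zero.2 (by fun_prop)) (contDiff_zero.2 (by fun_prop))

/-- The `x`-derivative of a function on the plane. -/
noncomputable def xDeriv (h : ℝ × ℝ → ℝ) (z : ℝ × ℝ) : ℝ := fderiv ℝ h z (1, 0)

theorem continuous_xDeriv {h : ℝ × ℝ → ℝ} (hh : ContDiff ℝ 1 h) : Continuous (xDeriv h) :=
  (hh.continuous_fderiv one_ne_zero).clm_apply continuous_const

theorem hasDerivAt_xDeriv {h : ℝ × ℝ → ℝ} (hh : ContDiff ℝ 1 h) (x t : ℝ) :
    HasDerivAt (fun y => h (y, t)) (xDeriv h (x, t)) x :=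
  ((hh.differentiable one_ne_zero (x, t)).hasFDerivAt).comp_hasDerivAt x
    ((hasDerivAt_id x).prodMk (hasDerivAt_const x t))

theorem contDiff_one_transport {σ : ℝ} {h : ℝ × ℝ → ℝ} (hh : ContDiff ℝ 1 h) :
    ContDiff ℝ 1 (transport σ h) := by
  have c := continuous_xDeriv hh
  have c₁ := continuous_transport (σ := σ) c
  have c₂ := hh.continuous
  exact contDiff_succ_of_partials (n := 0) (w₁ := transport σ (xDeriv h))
    (w₂ := fun z => σ * transport σ (xDeriv h) z + h z)
    (hasDerivAt_transport_fst c₂ c (hasDerivAt_xDeriv hh))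
    (hasDerivAt_transport_snd c₂ c (hasDerivAt_xDeriv hh))
    (contDiff_zero.2 c₁) (contDiff_zero.2 (by fun_prop))

/-- The first derivatives are combinations of `transport (±1) h`, and `transport` preserves `C¹`; so
one derivative is gained over the source. -/
theorem contDiff_two_duhamel {h : ℝ × ℝ → ℝ} (hh : ContDiff ℝ 1 h) : ContDiff ℝ 2 (duhamel h) := by
  have c₁ := contDiff_one_transport (σ := 1) hh
  have c₂ := contDiff_one_transport (σ := -1) hh
  have := contDiff_succ_of_partials (n := 1) (w := duhamel h)
    (w₁ := fun z => (transport 1 h z - transport (-1) h z) / 2)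
    (w₂ := fun z => (transport 1 h z + transport (-1) h z) / 2)
    (hasDerivAt_duhamel_fst hh.continuous) (hasDerivAt_duhamel_snd hh.continuous)
    (by fun_prop) (by fun_prop)
  convert this using 1
  norm_num

theorem duhamel_wave {h : ℝ × ℝ → ℝ} (hh : ContDiff ℝ 1 h) (x t : ℝ) :
    iteratedDeriv 2 (fun s => duhamel h (x, s)) t - iteratedDeriv 2 (fun y => duhamel h (y, t)) x
      = h (x, t) := by
  have c := continuous_xDeriv hh
  have d := hasDerivAt_xDeriv hh
  have e₁ : deriv (fun s => duhamel h (x, s)) =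
      fun s => (transport 1 h (x, s) + transport (-1) h (x, s)) / 2 :=
    funext fun s => (hasDerivAt_duhamel_snd hh.continuous x s).deriv
  have e₂ : deriv (fun y => duhamel h (y, t)) =
      fun y => (transport 1 h (y, t) - transport (-1) h (y, t)) / 2 :=
    funext fun y => (hasDerivAt_duhamel_fst hh.continuous y t).deriv
  rw [iteratedDeriv_succ, iteratedDeriv_one, iteratedDeriv_succ, iteratedDeriv_one, e₁, e₂,
    (((hasDerivAt_transport_snd (σ := 1) hh.continuous c d x t).fun_add
      (hasDerivAt_transport_snd (σ := -1) hh.continuous c d x t)).div_const 2).deriv,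
    (((hasDerivAt_transport_fst (σ := 1) hh.continuous c d x t).fun_sub
      (hasDerivAt_transport_fst (σ := -1) hh.continuous c d x t)).div_const 2).deriv]
  ring

/-! ### Continuity and regularity of the coefficients -/

theorem bracket_pos (x : ℝ) : 0 < bracket x := Real.sqrt_pos.2 (by positivity)

theorem contDiff_bracket {n : ℕ∞} : ContDiff ℝ n bracket :=
  (by fun_prop : ContDiff ℝ n fun x : ℝ => 1 + x ^ 2).sqrt fun x => by positivity

theorem contDiff_weight (a b : ℝ) {n : ℕ∞} :
    ContDiff ℝ n fun z : ℝ × ℝ => weight a b z.1 z.2 := by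
  have hb := contDiff_bracket (n := n)
  have h₁ : ContDiff ℝ n fun z : ℝ × ℝ => bracket (z.2 + bracket z.1) :=
    hb.comp (contDiff_snd.add (hb.comp contDiff_fst))
  have h₂ : ContDiff ℝ n fun z : ℝ × ℝ => bracket (z.2 - bracket z.1) :=
    hb.comp (contDiff_snd.sub (hb.comp contDiff_fst))
  exact (h₁.rpow_const_of_ne fun z => (bracket_pos _).ne').mul
    (h₂.rpow_const_of_ne fun z => (bracket_pos _).ne')

theorem weight_pos (a b x t : ℝ) : 0 < weight a b x t :=
  mul_pos (Real.rpow_pos_of_pos (bracket_pos _) _) (Real.rpow_pos_of_pos (bracket_pos _) _)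

theorem abs_rpow_sub_abs_rpow_le {p K x y : ℝ} (hp : 1 < p) (hx : |x| ≤ K) (hy : |y| ≤ K) :
    |(|x| ^ p - |y| ^ p)| ≤ p * K ^ (p - 1) * |x - y| := by
  have hK : 0 ≤ K := (abs_nonneg x).trans hx
  refine (convex_Icc (-K) K).norm_image_sub_le_of_norm_hasDerivWithin_le (𝕜 := ℝ)
    (f := fun x : ℝ => |x| ^ p)
    (fun z _ => (hasDerivAt_abs_rpow z hp).hasDerivWithinAt) (fun z hz => ?_)
    (abs_le.1 hy) (abs_le.1 hx)
  have hz' : |z| ≤ K := abs_le.2 hz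
  -- The derivative is `p |z|^{p-2} z`; merging the powers into `|z|^{p-1}` needs `z ≠ 0`.
  rcases eq_or_ne z 0 with rfl | h0
  · simp; positivity
  have : |z| ^ (p - 2) * |z| = |z| ^ (p - 1) := by
    rw [← Real.rpow_add_one (abs_ne_zero.2 h0)]; ring_nf
  rw [Real.norm_eq_abs, abs_mul, abs_mul, mul_assoc, abs_of_pos (by linarith : 0 < p),
    abs_of_nonneg (by positivity : 0 ≤ |z| ^ (p - 2)), this]
  gcongr

/-! ### Uniqueness -/

/-- `B/lam · exp(lam r) ∓ φ r` is nondecreasing. Each integration against the exponential weight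
thus gains a factor `1/lam`. -/
theorem abs_le_of_abs_deriv_le_exp {φ φ' : ℝ → ℝ} {B lam s : ℝ} (hl : 0 < lam) (hs : 0 ≤ s)
    (hB : 0 ≤ B) (hc : ContinuousOn φ (Icc 0 s)) (hd : ∀ r ∈ Ioo 0 s, HasDerivAt φ (φ' r) r)
    (hb : ∀ r ∈ Ioo 0 s, |φ' r| ≤ B * Real.exp (lam * r)) (h0 : φ 0 = 0) :
    |φ s| ≤ B / lam * Real.exp (lam * s) := by
  have hE : ∀ r, HasDerivAt (fun r => B / lam * Real.exp (lam * r)) (B * Real.exp (lam * r)) r :=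
    fun r => by
      have := (((hasDerivAt_id r).const_mul lam).exp).const_mul (B / lam)
      convert! this using 1
      simp only [id, mul_one]
      field_simp
  have hEc : Continuous fun r => B / lam * Real.exp (lam * r) := by fun_prop
  have key : ∀ σ : ℝ, |σ| = 1 → σ * φ s ≤ B / lam * Real.exp (lam * s) := by
    intro σ hσ
    have hm : MonotoneOn (fun r => B / lam * Real.exp (lam * r) - σ * φ r) (Icc 0 s) := by
      refine monotoneOn_of_deriv_nonneg (convex_Icc _ _)
        (hEc.continuousOn.sub (continuousOn_const.mul hc)) ?_ ?_
      · rw [interior_Icc]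
        exact fun r hr => ((hE r).fun_sub ((hd r hr).const_mul σ)).differentiableAt.differentiableWithinAt
      · rw [interior_Icc]
        intro r hr
        rw [((hE r).fun_sub ((hd r hr).const_mul σ)).deriv]
        have := (le_abs_self (σ * φ' r)).trans_eq (abs_mul _ _)
        rw [hσ, one_mul] at this
        linarith [hb r hr]
    have := hm ⟨le_rfl, hs⟩ ⟨hs, le_rfl⟩ hs
    simp only [h0, mul_zero, sub_zero, Real.exp_zero, mul_one] at this
    have : 0 ≤ B / lam := by positivity
    linarith
  refine abs_le.2 ⟨?_, ?_⟩
  · linarith [key (-1) (by simp)]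
  · linarith [key 1 (by simp)]

/-- The space-time strip `ℝ × [0,T)`. -/
def strip (T : ℝ) : Set (ℝ × ℝ) := univ ×ˢ Ico 0 T

theorem uniqueDiffOn_strip (T : ℝ) : UniqueDiffOn ℝ (strip T) :=
  uniqueDiffOn_univ.prod (uniqueDiffOn_Ico 0 T)

theorem strip_mem_nhds {T x t : ℝ} (ht : t ∈ Ioo 0 T) : strip T ∈ 𝓝 (x, t) :=
  prod_mem_nhds univ_mem (Ico_mem_nhds ht.1 ht.2)

theorem deriv_comp_line {w : ℝ × ℝ → ℝ} {γ : ℝ → ℝ × ℝ} {e : ℝ × ℝ} {r : ℝ}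
    (hγ : ∀ r, HasDerivAt γ e r) (hw : ContDiffAt ℝ 2 w (γ r)) :
    iteratedDeriv 2 (fun r => w (γ r)) r = fderiv ℝ (fderiv ℝ w) (γ r) e e := by
  have h1 : (deriv fun r => w (γ r)) =ᶠ[𝓝 r] fun r => fderiv ℝ w (γ r) e := by
    have : ∀ᶠ z in 𝓝 (γ r), ContDiffAt ℝ 2 w z := hw.eventually (by simp)
    filter_upwards [(hγ r).continuousAt.eventually this] with q hq
    exact ((hq.differentiableAt two_ne_zero).hasFDerivAt.comp_hasDerivAt q (hγ q)).deriv
  have h2 : DifferentiableAt ℝ (fderiv ℝ w) (γ r) :=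
    (hw.fderiv_right (m := 1) (by norm_num)).differentiableAt one_ne_zero
  rw [iteratedDeriv_succ, iteratedDeriv_one, h1.deriv_eq]
  have := (h2.hasFDerivAt.comp_hasDerivAt r (hγ r)).clm_apply (hasDerivAt_const r e)
  simpa using this.deriv

/-- The derivative `u_t + u_x` on the strip, one-sided at `t = 0`. -/
noncomputable def charDeriv (T : ℝ) (w : ℝ × ℝ → ℝ) (z : ℝ × ℝ) : ℝ :=
  fderivWithin ℝ w (strip T) z (1, 1)

theorem continuousOn_charDeriv {T : ℝ} {w : ℝ × ℝ → ℝ} (hw : ContDiffOn ℝ 2 w (strip T)) :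
    ContinuousOn (charDeriv T w) (strip T) :=
  (hw.continuousOn_fderivWithin (uniqueDiffOn_strip T) (by norm_num)).clm_apply continuousOn_const

theorem hasDerivAt_along {T c r : ℝ} {w : ℝ × ℝ → ℝ} (hw : ContDiffOn ℝ 2 w (strip T))
    (hr : r ∈ Ioo 0 T) :
    HasDerivAt (fun r => w (c + r, r)) (charDeriv T w (c + r, r)) r := by
  have hn := strip_mem_nhds (x := c + r) hr
  have h := (((hw _ (mem_of_mem_nhds hn)).contDiffAt hn).differentiableAt two_ne_zero).hasFDerivAt
  rw [← fderivWithin_of_mem_nhds hn] at h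
  exact h.comp_hasDerivAt (f := fun r => (c + r, r)) r
    (((hasDerivAt_id r).const_add c).prodMk (hasDerivAt_id r))

/-- This is the factorization `∂ₜ² - ∂ₓ² = (∂ₜ - ∂ₓ)(∂ₜ + ∂ₓ)`: the curve has velocity `(-1, 1)`,
and the mixed terms cancel by symmetry of the second derivative. -/
theorem hasDerivAt_charDeriv {T c r : ℝ} {w : ℝ × ℝ → ℝ} (hw : ContDiffOn ℝ 2 w (strip T))
    (hr : r ∈ Ioo 0 T) :
    HasDerivAt (fun r => charDeriv T w (c - r, r))
      (iteratedDeriv 2 (fun s => w (c - r, s)) r - iteratedDeriv 2 (fun y => w (y, r)) (c - r)) r := by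
  have hn := strip_mem_nhds (x := c - r) hr
  have hC : ContDiffAt ℝ 2 w (c - r, r) := (hw _ (mem_of_mem_nhds hn)).contDiffAt hn
  have h2 : DifferentiableAt ℝ (fderiv ℝ w) (c - r, r) :=
    (hC.fderiv_right (m := 1) (by norm_num)).differentiableAt one_ne_zero
  have hγ : HasDerivAt (fun r : ℝ => (c - r, r)) ((-1 : ℝ), (1 : ℝ)) r :=
    ((hasDerivAt_id r).const_sub c).prodMk (hasDerivAt_id r)
  have e₁ := deriv_comp_line (w := w) (γ := fun s => (c - r, s)) (e := (0, 1)) (r := r)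
    (fun s => (hasDerivAt_const s (c - r)).prodMk (hasDerivAt_id s)) hC
  have e₂ := deriv_comp_line (w := w) (γ := fun y => (y, r)) (e := (1, 0)) (r := c - r)
    (fun s => (hasDerivAt_id s).prodMk (hasDerivAt_const s r)) hC
  have hsymm := hC.isSymmSndFDerivAt (by simp) (0, 1) (1, 0)
  have hd := (h2.hasFDerivAt.comp_hasDerivAt (f := fun r => (c - r, r)) r hγ).clm_apply (hasDerivAt_const r ((1 : ℝ), (1 : ℝ)))
  have hev : (fun r => charDeriv T w (c - r, r)) =ᶠ[𝓝 r] fun r => fderiv ℝ w (c - r, r) (1, 1) := by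
    filter_upwards [Ioo_mem_nhds hr.1 hr.2] with q hq
    rw [charDeriv, fderivWithin_of_mem_nhds (strip_mem_nhds hq)]
  refine HasDerivAt.congr_of_eventuallyEq ?_ hev
  rw [e₁, e₂]
  convert! hd using 1
  have a₁ : ((-1 : ℝ), (1 : ℝ)) = (0, 1) - (1, 0) := by simp
  have a₂ : ((1 : ℝ), (1 : ℝ)) = (0, 1) + (1, 0) := by simp
  rw [a₁, a₂]
  simp only [map_sub, map_add, sub_apply, map_zero, add_zero]
  linarith

/-- Supplies the starting value for integration along characteristics. On the boundary of the strip,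
the derivative within the strip is matched with the one-sided time derivative by unique
differentiability. -/
theorem charDeriv_zero {T c d : ℝ} {w : ℝ × ℝ → ℝ} (hT : 0 < T) (hw : ContDiffOn ℝ 2 w (strip T))
    (hd : HasDerivWithinAt (fun s => w (c, s)) d (Ici 0) 0) :
    charDeriv T w (c, 0) = deriv (fun y => w (y, 0)) c + d := by
  have h0 : (0 : ℝ) ∈ Ico 0 T := ⟨le_rfl, hT⟩
  have hS : (c, (0 : ℝ)) ∈ strip T := ⟨mem_univ _, h0⟩
  have h := ((hw _ hS).differentiableWithinAt two_ne_zero).hasFDerivWithinAt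
  have hx : HasDerivAt (fun y => w (y, 0)) (fderivWithin ℝ w (strip T) (c, 0) (1, 0)) c := by
    rw [← hasDerivWithinAt_univ]
    exact h.comp_hasDerivWithinAt (f := fun y => (y, (0 : ℝ))) c
      ((hasDerivAt_id c).prodMk (hasDerivAt_const c (0 : ℝ))).hasDerivWithinAt
      (fun y _ => ⟨mem_univ _, h0⟩)
  have ht : HasDerivWithinAt (fun s => w (c, s)) (fderivWithin ℝ w (strip T) (c, 0) (0, 1))
      (Ico 0 T) 0 :=
    h.comp_hasDerivWithinAt (f := fun s => (c, s)) 0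
      ((hasDerivAt_const (0 : ℝ) c).prodMk (hasDerivAt_id (0 : ℝ))).hasDerivWithinAt
      (fun s hs => ⟨mem_univ _, hs⟩)
  have e : fderivWithin ℝ w (strip T) (c, 0) (0, 1) = d :=
    (uniqueDiffOn_Ico 0 T 0 h0).eq_deriv _ ht (hd.mono fun s hs => hs.1)
  rw [hx.deriv, ← e, charDeriv, ← map_add]
  simp

/-- Integrate first `u_t + u_x` along `x + t = const`, then `u` along `x - t = const`. Both paths
back to `t = 0` stay in the triangle, and each costs `1/lam`. -/
theorem abs_sub_le_on_triangle {T A lam x₀ t₀ : ℝ} {u v : ℝ × ℝ → ℝ} (hlam : 0 < lam) (ht : t₀ < T)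
    (hu : ContDiffOn ℝ 2 u (strip T)) (hv : ContDiffOn ℝ 2 v (strip T)) (hA : 0 ≤ A)
    (h0 : ∀ x, u (x, 0) = v (x, 0)) (h1 : ∀ x, charDeriv T u (x, 0) = charDeriv T v (x, 0))
    (hbox : ∀ y s, 0 < s → |y - x₀| ≤ t₀ - s →
      |(iteratedDeriv 2 (fun s => u (y, s)) s - iteratedDeriv 2 (fun y => u (y, s)) y) -
        (iteratedDeriv 2 (fun s => v (y, s)) s - iteratedDeriv 2 (fun y => v (y, s)) y)|
        ≤ A * Real.exp (lam * s)) {y s : ℝ} (hs : 0 ≤ s) (hy : |y - x₀| ≤ t₀ - s) :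
    |u (y, s) - v (y, s)| ≤ A / lam / lam * Real.exp (lam * s) := by
  have hst : s < T := by linarith [abs_nonneg (y - x₀)]
  have hp : ∀ y s, 0 ≤ s → |y - x₀| ≤ t₀ - s →
      |charDeriv T u (y, s) - charDeriv T v (y, s)| ≤ A / lam * Real.exp (lam * s) := by
    intro y s hs hy
    have hst : s < T := by linarith [abs_nonneg (y - x₀)]
    have hmaps : MapsTo (fun r => (y + s - r, r)) (Icc 0 s) (strip T) :=
      fun r hr => ⟨mem_univ _, hr.1, hr.2.trans_lt hst⟩
    have hγ : ContinuousOn (fun r => (y + s - r, r)) (Icc 0 s) := by fun_prop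
    have := abs_le_of_abs_deriv_le_exp
      (φ := fun r => charDeriv T u (y + s - r, r) - charDeriv T v (y + s - r, r)) hlam hs hA
      (((continuousOn_charDeriv hu).comp hγ hmaps).sub ((continuousOn_charDeriv hv).comp hγ hmaps))
      (fun r hr => (hasDerivAt_charDeriv hu ⟨hr.1, hr.2.trans hst⟩).fun_sub
        (hasDerivAt_charDeriv hv ⟨hr.1, hr.2.trans hst⟩))
      (fun r hr => hbox _ _ hr.1 ?_) (by simp [h1])
    · simpa using this
    · rw [abs_le] at hy ⊢
      constructor <;> linarith [hr.2, hr.1]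
  have hmaps : MapsTo (fun r => (y - s + r, r)) (Icc 0 s) (strip T) :=
    fun r hr => ⟨mem_univ _, hr.1, hr.2.trans_lt hst⟩
  have hγ : ContinuousOn (fun r => (y - s + r, r)) (Icc 0 s) := by fun_prop
  have := abs_le_of_abs_deriv_le_exp
    (φ := fun r => u (y - s + r, r) - v (y - s + r, r)) hlam hs (by positivity : 0 ≤ A / lam)
    ((hu.continuousOn.comp hγ hmaps).sub (hv.continuousOn.comp hγ hmaps))
    (fun r hr => (hasDerivAt_along hu ⟨hr.1, hr.2.trans hst⟩).fun_sub
      (hasDerivAt_along hv ⟨hr.1, hr.2.trans hst⟩))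
    (fun r hr => hp _ _ hr.1.le ?_) (by simp [h0])
  · simpa using this
  · rw [abs_le] at hy ⊢
    constructor <;> linarith [hr.2, hr.1]

theorem IsClassicalSolution.unique {p a b ε T : ℝ} {f g : ℝ → ℝ} {u v : ℝ → ℝ → ℝ} (hp : 1 < p)
    (hu : IsClassicalSolution p a b ε f g T u) (hv : IsClassicalSolution p a b ε f g T v)
    (x₀ t₀ : ℝ) (ht₀ : t₀ ∈ Ico 0 T) : v x₀ t₀ = u x₀ t₀ := by
  have hT : 0 < T := ht₀.1.trans_lt ht₀.2
  let U : ℝ × ℝ → ℝ := fun z => u z.1 z.2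
  let V : ℝ × ℝ → ℝ := fun z => v z.1 z.2
  have cU : ContDiffOn ℝ 2 U (strip T) := hu.contDiffOn
  have cV : ContDiffOn ℝ 2 V (strip T) := hv.contDiffOn
  let D : Set (ℝ × ℝ) := {z | 0 ≤ z.2 ∧ |z.1 - x₀| ≤ t₀ - z.2}
  have hDT : D ⊆ strip T := fun z hz =>
    ⟨mem_univ _, hz.1, by linarith [abs_nonneg (z.1 - x₀), hz.2, ht₀.2]⟩
  have hDc : IsCompact D := by
    refine IsCompact.of_isClosed_subset
      ((isCompact_Icc (a := x₀ - t₀) (b := x₀ + t₀)).prod (isCompact_Icc (a := 0) (b := t₀)))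
      ?_ ?_
    · exact (isClosed_le continuous_const continuous_snd).inter
        (isClosed_le (f := fun z : ℝ × ℝ => |z.1 - x₀|) (g := fun z => t₀ - z.2)
          (by fun_prop) (by fun_prop))
    rintro ⟨y, s⟩ ⟨h1, h2⟩
    simp only at h1 h2
    have := abs_le.1 h2
    exact ⟨⟨by linarith, by linarith⟩, h1, by linarith⟩
  have hmem : (x₀, t₀) ∈ D := ⟨ht₀.1, by simp⟩
  obtain ⟨K₁, hK₁⟩ := hDc.exists_bound_of_continuousOn (cU.continuousOn.mono hDT)
  obtain ⟨K₂, hK₂⟩ := hDc.exists_bound_of_continuousOn (cV.continuousOn.mono hDT)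
  obtain ⟨C, hC⟩ := hDc.exists_bound_of_continuousOn
    (contDiff_weight a b (n := 0)).continuous.continuousOn
  obtain ⟨K, hK⟩ : ∃ K, K = max K₁ K₂ := ⟨_, rfl⟩
  replace hK₁ : ∀ z ∈ D, |U z| ≤ K := fun z hz => (hK₁ z hz).trans (hK ▸ le_max_left _ _)
  replace hK₂ : ∀ z ∈ D, |V z| ≤ K := fun z hz => (hK₂ z hz).trans (hK ▸ le_max_right _ _)
  have hK0 : 0 ≤ K := (abs_nonneg _).trans (hK₁ _ hmem)
  have hC0 : 0 ≤ C := (norm_nonneg _).trans (hC _ hmem)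
  -- `Λ` is a Lipschitz constant of the source on the range of both solutions over the triangle;
  -- `lam = 1 + Λ` makes `Λ / lam² < 1`.
  obtain ⟨Λ, hΛ⟩ : ∃ Λ, Λ = C * (p * K ^ (p - 1)) := ⟨_, rfl⟩
  have hΛ0 : 0 ≤ Λ := by rw [hΛ]; positivity
  obtain ⟨lam, hlam'⟩ : ∃ l, l = 1 + Λ := ⟨_, rfl⟩
  have hlam : 0 < lam := by linarith
  -- At a maximum of the weighted difference, two integrations give `M ≤ (Λ / lam²) M`, which forces
  -- `M = 0`.
  obtain ⟨z, hzD, hz⟩ := hDc.exists_isMaxOn ⟨_, hmem⟩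
    (f := fun z => |U z - V z| * Real.exp (-(lam * z.2)))
    ((((cU.continuousOn.mono hDT).sub (cV.continuousOn.mono hDT)).abs).mul (by fun_prop))
  obtain ⟨M, hM⟩ : ∃ M, M = |U z - V z| * Real.exp (-(lam * z.2)) := ⟨_, rfl⟩
  have hM0 : 0 ≤ M := by rw [hM]; positivity
  have hbd : ∀ y ∈ D, |U y - V y| ≤ M * Real.exp (lam * y.2) := by
    intro y hy
    have : |U y - V y| * Real.exp (-(lam * y.2)) ≤ M := hM ▸ hz hy
    rw [Real.exp_neg, ← div_eq_mul_inv, div_le_iff₀ (Real.exp_pos _)] at this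
    exact this
  have hbox : ∀ y s, 0 < s → |y - x₀| ≤ t₀ - s →
      |(iteratedDeriv 2 (fun s => U (y, s)) s - iteratedDeriv 2 (fun y => U (y, s)) y) -
        (iteratedDeriv 2 (fun s => V (y, s)) s - iteratedDeriv 2 (fun y => V (y, s)) y)|
        ≤ Λ * M * Real.exp (lam * s) := by
    intro y s hs hy
    have hyD : (y, s) ∈ D := ⟨hs.le, hy⟩
    have e₁ := hu.equation y s ⟨hs, (hDT hyD).2.2⟩
    have e₂ := hv.equation y s ⟨hs, (hDT hyD).2.2⟩
    change |(iteratedDeriv 2 (fun s => u y s) s - iteratedDeriv 2 (fun y => u y s) y) -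
        (iteratedDeriv 2 (fun s => v y s) s - iteratedDeriv 2 (fun y => v y s) y)| ≤ _
    rw [e₁, e₂, ← mul_sub, abs_mul]
    have l₁ : |weight a b y s| ≤ C := hC (y, s) hyD
    have l₂ := abs_rpow_sub_abs_rpow_le hp (hK₁ (y, s) hyD) (hK₂ (y, s) hyD)
    have l₃ : p * K ^ (p - 1) * |U (y, s) - V (y, s)| ≤ p * K ^ (p - 1) * (M * Real.exp (lam * s)) :=
      mul_le_mul_of_nonneg_left (hbd (y, s) hyD) (by positivity)
    refine (mul_le_mul l₁ (l₂.trans l₃) (abs_nonneg _) hC0).trans_eq ?_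
    rw [hΛ]; ring
  have h1 : ∀ x, charDeriv T U (x, 0) = charDeriv T V (x, 0) := by
    intro x
    rw [charDeriv_zero hT cU (hu.initial_deriv x), charDeriv_zero hT cV (hv.initial_deriv x)]
    simp only [U, V, hu.initial, hv.initial]
  have hfin := abs_sub_le_on_triangle hlam ht₀.2 cU cV (mul_nonneg hΛ0 hM0)
    (fun x => by simp only [U, V, hu.initial, hv.initial]) h1 hbox hzD.1 hzD.2
  have hM2 : M ≤ Λ * M / lam / lam := by
    refine hM.trans_le ?_
    rw [Real.exp_neg, ← div_eq_mul_inv, div_le_iff₀ (Real.exp_pos _)]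
    exact hfin
  have hM3 : M = 0 := by
    by_contra hne
    have hpos : 0 < M := lt_of_le_of_ne hM0 (Ne.symm hne)
    rw [div_div, le_div_iff₀ (by positivity)] at hM2
    have : lam * lam ≤ Λ := by nlinarith
    nlinarith
  have := hbd (x₀, t₀) hmem
  rw [hM3, zero_mul] at this
  linarith [abs_nonpos_iff.1 this, (rfl : U (x₀, t₀) = u x₀ t₀), (rfl : V (x₀, t₀) = v x₀ t₀)]

/-! ### Global solutions for bounded Lipschitz sources -/

theorem continuous_integral_section {h : ℝ × ℝ → ℝ} (hh : Continuous h) {α β : ℝ → ℝ}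
    (hα : Continuous α) (hβ : Continuous β) :
    Continuous fun s => ∫ y in (α s)..(β s), h (y, s) := by
  have hc := continuous_xPrim hh
  have e : (fun s => ∫ y in (α s)..(β s), h (y, s)) =
      fun s => xPrim h (β s, s) - xPrim h (α s, s) := by
    ext s
    exact (intervalIntegral.integral_interval_sub_left
      ((by fun_prop : Continuous fun y => h (y, s)).intervalIntegrable _ _)
      ((by fun_prop : Continuous fun y => h (y, s)).intervalIntegrable _ _)).symm
  rw [e]
  fun_prop

theorem duhamel_sub {h k : ℝ × ℝ → ℝ} (hh : Continuous h) (hk : Continuous k) (z : ℝ × ℝ) :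
    duhamel (fun z => h z - k z) z = duhamel h z - duhamel k z := by
  rw [duhamel, duhamel, duhamel, ← mul_sub, ← intervalIntegral.integral_sub]
  · refine congrArg (1 / 2 * ·) (intervalIntegral.integral_congr fun s _ => ?_)
    exact intervalIntegral.integral_sub
      ((by fun_prop : Continuous fun y => h (y, s)).intervalIntegrable _ _)
      ((by fun_prop : Continuous fun y => k (y, s)).intervalIntegrable _ _)
  · exact (continuous_integral_section hh (by fun_prop) (by fun_prop)).intervalIntegrable _ _
  · exact (continuous_integral_section hk (by fun_prop) (by fun_prop)).intervalIntegrable _ _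

theorem integral_sub_mul_cosh {lam : ℝ} (hlam : 0 < lam) (t : ℝ) :
    ∫ s in (0 : ℝ)..t, (t - s) * Real.cosh (lam * s) = (Real.cosh (lam * t) - 1) / lam ^ 2 := by
  have hd : ∀ s, HasDerivAt (fun s => (t - s) * (Real.sinh (lam * s) / lam)
      + Real.cosh (lam * s) / lam ^ 2) ((t - s) * Real.cosh (lam * s)) s := by
    intro s
    have h1 : HasDerivAt (fun s => lam * s) lam s := by simpa using (hasDerivAt_id s).const_mul lam
    have := ((((hasDerivAt_id s).const_sub t).fun_mul (h1.sinh.div_const lam))).fun_add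
      (h1.cosh.div_const (lam ^ 2))
    convert! this using 1
    simp only [id]
    field_simp
    ring
  rw [intervalIntegral.integral_eq_sub_of_hasDerivAt (fun s _ => hd s)
    ((by fun_prop : Continuous fun s => (t - s) * Real.cosh (lam * s)).intervalIntegrable _ _)]
  simp
  ring

/-- The weight `cosh(lam t)` satisfies `y'' = lam² y`, so the double integration gains `lam⁻²`;
being even, it serves both signs of time. -/
theorem abs_duhamel_le_cosh {h : ℝ × ℝ → ℝ} {C lam : ℝ} (hlam : 0 < lam)
    (hb : ∀ z, |h z| ≤ C * Real.cosh (lam * z.2)) (z : ℝ × ℝ) :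
    |duhamel h z| ≤ C / lam ^ 2 * Real.cosh (lam * z.2) := by
  obtain ⟨x, t⟩ := z
  have hC : 0 ≤ C := by simpa using (abs_nonneg _).trans (hb 0)
  have hin : ∀ s, ‖∫ y in (x - (t - s))..(x + (t - s)), h (y, s)‖ ≤
      2 * C * (|t - s| * Real.cosh (lam * s)) := by
    intro s
    have := intervalIntegral.norm_integral_le_of_norm_le_const (a := x - (t - s))
      (b := x + (t - s)) (f := fun y => h (y, s)) (C := C * Real.cosh (lam * s))
      (fun y _ => hb (y, s))
    refine this.trans_eq ?_
    have : x + (t - s) - (x - (t - s)) = 2 * (t - s) := by ring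
    rw [this, abs_mul]
    simp
    ring
  have hout : |∫ s in (0 : ℝ)..t, ∫ y in (x - (t - s))..(x + (t - s)), h (y, s)| ≤
      |∫ s in (0 : ℝ)..t, 2 * C * ((t - s) * Real.cosh (lam * s))| := by
    have hi : ∀ c : ℝ, IntervalIntegrable (fun s => c * (2 * C * ((t - s) * Real.cosh (lam * s))))
        volume 0 t := fun c => (by fun_prop : Continuous fun s =>
          c * (2 * C * ((t - s) * Real.cosh (lam * s)))).intervalIntegrable _ _
    -- `t - s` has constant sign between `0` and `t`; the factor `c = ±1` records it.
    have key : ∀ c : ℝ, |c| = 1 → (∀ s ∈ uIoc 0 t, |t - s| = c * (t - s)) →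
        |∫ s in (0 : ℝ)..t, ∫ y in (x - (t - s))..(x + (t - s)), h (y, s)| ≤
          |∫ s in (0 : ℝ)..t, 2 * C * ((t - s) * Real.cosh (lam * s))| := by
      intro c hc hs
      have := intervalIntegral.norm_integral_le_abs_of_norm_le
        (f := fun s => ∫ y in (x - (t - s))..(x + (t - s)), h (y, s)) (μ := volume)
        (ae_restrict_of_forall_mem measurableSet_uIoc fun s hmem =>
          (hin s).trans_eq (?_ : _ = c * (2 * C * ((t - s) * Real.cosh (lam * s))))) (hi c)
      · rwa [intervalIntegral.integral_const_mul, abs_mul, hc, one_mul] at this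
      · rw [hs s hmem]; ring
    rcases le_total 0 t with ht | ht
    · refine key 1 (by simp) fun s hs => ?_
      rw [uIoc_of_le ht] at hs
      rw [abs_of_nonneg (by linarith [hs.2]), one_mul]
    · refine key (-1) (by simp) fun s hs => ?_
      rw [uIoc_of_ge ht] at hs
      rw [abs_of_nonpos (by linarith [hs.1])]; ring
  rw [intervalIntegral.integral_const_mul, integral_sub_mul_cosh hlam] at hout
  have h1 := Real.one_le_cosh (lam * t)
  have h0 : 0 ≤ (Real.cosh (lam * t) - 1) / lam ^ 2 := div_nonneg (sub_nonneg.2 h1) (by positivity)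
  rw [abs_of_nonneg (by positivity : 0 ≤ 2 * C * ((Real.cosh (lam * t) - 1) / lam ^ 2))] at hout
  rw [duhamel, abs_mul, abs_of_pos (by norm_num : (0 : ℝ) < 1 / 2)]
  have h2 : (Real.cosh (lam * t) - 1) / lam ^ 2 ≤ Real.cosh (lam * t) / lam ^ 2 := by
    gcongr; linarith
  have h3 := mul_le_mul_of_nonneg_left h2 hC
  calc _ ≤ 1 / 2 * (2 * C * ((Real.cosh (lam * t) - 1) / lam ^ 2)) := by gcongr
    _ = C * ((Real.cosh (lam * t) - 1) / lam ^ 2) := by ring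
    _ ≤ _ := h3.trans_eq (by ring)

open BoundedContinuousFunction in
-- Dividing by `cosh(lam t)` makes the Duhamel map a contraction of bounded continuous functions.
-- The pointwise bound `B` is not needed for contraction; it is only inherited by the limit of the
-- iterates.
theorem exists_duhamel_fixedPoint {m : ℝ × ℝ → ℝ → ℝ} {C Λ : ℝ}
    (hm : Continuous fun q : (ℝ × ℝ) × ℝ => m q.1 q.2) (hC : ∀ z y, |m z y| ≤ C)
    (hΛ : ∀ z y y', |m z y - m z y'| ≤ Λ * |y - y'|) {Ω : Set (ℝ × ℝ)} {B : ℝ × ℝ → ℝ}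
    (hB : ∀ z ∈ Ω, 0 ≤ B z)
    (hinv : ∀ v : ℝ × ℝ → ℝ, Continuous v → (∀ z ∈ Ω, |v z| ≤ B z) →
      ∀ z ∈ Ω, |duhamel (fun z => m z (v z)) z| ≤ B z) :
    ∃ v : ℝ × ℝ → ℝ, Continuous v ∧ (∀ z, v z = duhamel (fun z => m z (v z)) z) ∧
      ∀ z ∈ Ω, |v z| ≤ B z := by
  have hC0 : 0 ≤ C := (abs_nonneg _).trans (hC 0 0)
  have hΛ0 : 0 ≤ Λ := by simpa using (abs_nonneg _).trans (hΛ 0 1 0)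
  -- `(1 + Λ)² ≥ 2Λ`, hence the contraction factor `Λ / lam² ≤ 1/2`.
  obtain ⟨lam, hlam'⟩ : ∃ l : ℝ, l = 1 + Λ := ⟨_, rfl⟩
  have hlam : 0 < lam := by linarith
  have hcp : ∀ z : ℝ × ℝ, 0 < Real.cosh (lam * z.2) := fun z => Real.cosh_pos _
  have hsrc : ∀ w : (ℝ × ℝ) →ᵇ ℝ, Continuous fun z : ℝ × ℝ => m z (Real.cosh (lam * z.2) * w z) :=
    fun w => hm.comp (by fun_prop : Continuous fun z : ℝ × ℝ => (z, Real.cosh (lam * z.2) * w z))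
  let Φ : ((ℝ × ℝ) →ᵇ ℝ) → ((ℝ × ℝ) →ᵇ ℝ) := fun w =>
    BoundedContinuousFunction.ofNormedAddCommGroup
      (fun z => duhamel (fun z => m z (Real.cosh (lam * z.2) * w z)) z / Real.cosh (lam * z.2))
      ((continuous_duhamel (hsrc w)).div (by fun_prop) fun z => (hcp z).ne') (C / lam ^ 2)
      (fun z => by
        rw [Real.norm_eq_abs, abs_div, abs_of_pos (hcp z), div_le_iff₀ (hcp z)]
        refine abs_duhamel_le_cosh hlam (fun z => (hC _ _).trans ?_) z
        exact le_mul_of_one_le_right hC0 (Real.one_le_cosh _))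
  have hΦ : ∀ w z, Real.cosh (lam * z.2) * Φ w z =
      duhamel (fun z => m z (Real.cosh (lam * z.2) * w z)) z :=
    fun w z => mul_div_cancel₀ _ (hcp z).ne'
  have hcontr : ContractingWith (1 / 2) Φ := by
    refine ⟨by rw [div_lt_one] <;> norm_num, LipschitzWith.of_dist_le_mul fun w₁ w₂ => ?_⟩
    refine (BoundedContinuousFunction.dist_le (by positivity)).2 fun z => ?_
    rw [Real.dist_eq]
    have e : Φ w₁ z - Φ w₂ z = duhamel (fun z => m z (Real.cosh (lam * z.2) * w₁ z)
        - m z (Real.cosh (lam * z.2) * w₂ z)) z / Real.cosh (lam * z.2) := by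
      rw [duhamel_sub (hsrc w₁) (hsrc w₂), ← hΦ, ← hΦ, ← mul_sub, mul_div_cancel_left₀ _ (hcp z).ne']
    rw [e, abs_div, abs_of_pos (hcp z), div_le_iff₀ (hcp z)]
    refine (abs_duhamel_le_cosh (C := Λ * dist w₁ w₂) hlam (fun z => (hΛ _ _ _).trans ?_) z).trans ?_
    · rw [← mul_sub, abs_mul, abs_of_pos (hcp z), mul_assoc, mul_comm (dist _ _)]
      gcongr
      exact w₁.dist_coe_le_dist z
    · refine mul_le_mul_of_nonneg_right ?_ (hcp z).le
      have : Λ / lam ^ 2 ≤ 1 / 2 := by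
        rw [div_le_div_iff₀ (by positivity) two_pos]; nlinarith [sq_nonneg Λ]
      calc Λ * dist w₁ w₂ / lam ^ 2 = Λ / lam ^ 2 * dist w₁ w₂ := by ring
        _ ≤ 1 / 2 * dist w₁ w₂ := by gcongr
        _ = _ := by simp
  -- `S` is closed, contains `0` and is mapped into itself, so it contains the limit of the iterates
  -- of `0`.
  let S : Set ((ℝ × ℝ) →ᵇ ℝ) := {w | ∀ z ∈ Ω, |Real.cosh (lam * z.2) * w z| ≤ B z}
  have hS : IsClosed S := by
    have : S = ⋂ z ∈ Ω, {w : (ℝ × ℝ) →ᵇ ℝ | |Real.cosh (lam * z.2) * w z| ≤ B z} := by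
      ext w; simp [S]
    rw [this]
    refine isClosed_biInter fun z _ => isClosed_le ?_ continuous_const
    exact (continuous_const.mul (continuous_eval_const z)).abs
  have hSmaps : ∀ w ∈ S, Φ w ∈ S := fun w hw z hz => by
    rw [hΦ]
    exact hinv (fun z => Real.cosh (lam * z.2) * w z) (by fun_prop) hw z hz
  have hS0 : (0 : (ℝ × ℝ) →ᵇ ℝ) ∈ S := fun z hz => by simpa using hB z hz
  have hiter : ∀ n, Φ^[n] 0 ∈ S := fun n => by
    induction n with
    | zero => exact hS0
    | succ n ih => rw [Function.iterate_succ_apply']; exact hSmaps _ ih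
  have hfix := hcontr.fixedPoint_isFixedPt
  have hmem : ContractingWith.fixedPoint Φ hcontr ∈ S :=
    hS.mem_of_tendsto (hcontr.tendsto_iterate_fixedPoint 0) (Eventually.of_forall hiter)
  refine ⟨fun z => Real.cosh (lam * z.2) * ContractingWith.fixedPoint Φ hcontr z, by fun_prop,
    fun z => ?_, hmem⟩
  rw [← hΦ, hfix.eq]

/-! ### The weight on the light cone -/

/-- The exponents `-(1+a)` and `-(1+b)` may have either sign, so comparability is needed in both
directions. -/
theorem rpow_le_of_comparable {c x z r : ℝ} (hx : 0 < x) (hc : 1 ≤ c) (h1 : x ≤ c * z)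
    (h2 : z ≤ c * x) : z ^ r ≤ c ^ |r| * x ^ r := by
  have hz : 0 < z := by
    by_contra h
    nlinarith
  rcases le_total 0 r with hr | hr
  · rw [abs_of_nonneg hr, ← Real.mul_rpow (by linarith) hx.le]
    exact Real.rpow_le_rpow hz.le h2 hr
  · rw [abs_of_nonpos hr, Real.rpow_neg (by linarith), ← Real.inv_rpow (by linarith),
      ← Real.mul_rpow (by positivity) hx.le]
    refine Real.rpow_le_rpow_of_nonpos (by positivity) ?_ hr
    rw [inv_mul_le_iff₀ (by linarith)]
    exact h1

theorem bracket_le (x : ℝ) : bracket x ≤ 1 + |x| := by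
  rw [bracket, Real.sqrt_le_left (by positivity)]
  nlinarith [abs_nonneg x, sq_abs x]

theorem abs_le_bracket (x : ℝ) : |x| ≤ bracket x :=
  Real.abs_le_sqrt (by linarith)

theorem one_le_bracket (x : ℝ) : 1 ≤ bracket x :=
  Real.one_le_sqrt.2 (by nlinarith [sq_nonneg x])

/-- From `|y| ≤ ⟨y⟩ ≤ 1 + |y|`: in the cone `s + ⟨y⟩` is comparable to `1 + s`, while `s - ⟨y⟩` and
`s - |y|` differ by at most one. -/
theorem weight_le {a b R y s : ℝ} (hR : 0 ≤ R) (hs : 0 ≤ s) (hy : |y| ≤ s + R) :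
    weight a b y s ≤ (2 + R) ^ |-(1 + a)| * 4 ^ |-(1 + b)| *
      ((1 + |s|) ^ (-(1 + a)) * (1 + |(s - |y|)|) ^ (-(1 + b))) := by
  have h1 := abs_le_bracket y
  have h2 := bracket_le y
  have h3 := bracket_le (s + bracket y)
  have h4 := abs_le_bracket (s + bracket y)
  have h5 := one_le_bracket (s + bracket y)
  have h6 := bracket_le (s - bracket y)
  have h7 := abs_le_bracket (s - bracket y)
  have h8 := one_le_bracket (s - bracket y)
  have h9 := abs_nonneg y
  rw [abs_of_nonneg (by linarith)] at h3 h4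
  have h10 : |s - bracket y| ≤ |(s - |y|)| + 1 := by
    rw [abs_le]; constructor <;> linarith [neg_abs_le (s - |y|), le_abs_self (s - |y|)]
  have h11 : |(s - |y|)| ≤ |s - bracket y| + 1 := by
    rw [abs_le]; constructor <;> linarith [neg_abs_le (s - bracket y), le_abs_self (s - bracket y)]
  have e₁ := rpow_le_of_comparable (r := -(1 + a)) (c := 2 + R) (x := 1 + |s|)
    (z := bracket (s + bracket y)) (by positivity) (by linarith)
    (by rw [abs_of_nonneg hs]; nlinarith) (by rw [abs_of_nonneg hs]; nlinarith)
  have e₂ := rpow_le_of_comparable (r := -(1 + b)) (c := 4) (x := 1 + |(s - |y|)|)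
    (z := bracket (s - bracket y)) (by positivity) (by linarith)
    (by linarith) (by linarith [abs_nonneg (s - |y|)])
  calc weight a b y s ≤ ((2 + R) ^ |-(1 + a)| * (1 + |s|) ^ (-(1 + a))) *
        (4 ^ |-(1 + b)| * (1 + |(s - |y|)|) ^ (-(1 + b))) := by
        refine mul_le_mul e₁ e₂ (Real.rpow_nonneg (bracket_pos _).le _) (by positivity)
    _ = _ := by ring

/-! ### Integrals of powers -/

theorem continuous_one_add_abs_rpow {X : Type*} [TopologicalSpace X] {φ : X → ℝ}
    (hφ : Continuous φ) (r : ℝ) : Continuous fun x => (1 + |φ x|) ^ r :=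
  (by fun_prop : Continuous fun x => 1 + |φ x|).rpow_const fun x => Or.inl (by positivity)

/-- `∫_0^T (1+|s|)^{-(1+k)} ds`. -/
noncomputable def powInt (k T : ℝ) : ℝ := ∫ s in (0 : ℝ)..T, (1 + |s|) ^ (-(1 + k))

theorem intervalIntegrable_pow (k α β : ℝ) :
    IntervalIntegrable (fun s : ℝ => (1 + |s|) ^ (-(1 + k))) volume α β :=
  (continuous_one_add_abs_rpow continuous_id _).intervalIntegrable _ _

theorem continuous_powInt (k : ℝ) : Continuous (powInt k) :=
  intervalIntegral.continuous_primitive (fun _ _ => intervalIntegrable_pow k _ _) 0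

theorem powInt_nonneg {k T : ℝ} (hT : 0 ≤ T) : 0 ≤ powInt k T :=
  intervalIntegral.integral_nonneg hT fun s _ => by positivity

/-- By evenness it is twice the half with `y ≥ 0`, and `z = s - y` carries that half to `[-r, s]`.
-/
theorem integral_cone_slice {k s r : ℝ} (h : 0 ≤ s + r) :
    ∫ y in (-(s + r))..(s + r), (1 + |(s - |y|)|) ^ (-(1 + k)) = 2 * (powInt k s + powInt k r) := by
  have hc : Continuous fun y : ℝ => (1 + |(s - |y|)|) ^ (-(1 + k)) :=
    continuous_one_add_abs_rpow (by fun_prop) _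
  have hpos : ∫ y in (0 : ℝ)..(s + r), (1 + |(s - |y|)|) ^ (-(1 + k)) = powInt k s + powInt k r := by
    have e₁ : ∫ y in (0 : ℝ)..(s + r), (1 + |(s - |y|)|) ^ (-(1 + k)) =
        ∫ y in (0 : ℝ)..(s + r), (1 + |s - y|) ^ (-(1 + k)) := by
      refine intervalIntegral.integral_congr fun y hy => ?_
      rw [uIcc_of_le h] at hy
      simp only [abs_of_nonneg hy.1]
    have e₂ : ∫ z in (-r)..0, (1 + |z|) ^ (-(1 + k)) = powInt k r := by
      have := intervalIntegral.integral_comp_neg (a := 0) (b := r)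
        fun z : ℝ => (1 + |z|) ^ (-(1 + k))
      simp only [abs_neg, neg_zero] at this
      exact this.symm
    rw [e₁, intervalIntegral.integral_comp_sub_left (fun z => (1 + |z|) ^ (-(1 + k))) s,
      show s - (s + r) = -r by ring, sub_zero,
      ← intervalIntegral.integral_add_adjacent_intervals (intervalIntegrable_pow k (-r) 0)
        (intervalIntegrable_pow k 0 s), e₂, add_comm]
    rfl
  have hneg : ∫ y in (-(s + r))..0, (1 + |(s - |y|)|) ^ (-(1 + k)) =
      ∫ y in (0 : ℝ)..(s + r), (1 + |(s - |y|)|) ^ (-(1 + k)) := by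
    have := intervalIntegral.integral_comp_neg (a := 0) (b := s + r)
      fun y : ℝ => (1 + |(s - |y|)|) ^ (-(1 + k))
    simp only [abs_neg, neg_zero] at this
    exact this.symm
  rw [← intervalIntegral.integral_add_adjacent_intervals (hc.intervalIntegrable _ 0)
    (hc.intervalIntegrable 0 _), hneg, hpos]
  ring

theorem powInt_eq_of_ne_zero {k T : ℝ} (hk : k ≠ 0) (hT : 0 ≤ T) :
    powInt k T = (1 - (1 + T) ^ (-k)) / k := by
  have hd : ∀ s ∈ uIcc 0 T, HasDerivAt (fun s : ℝ => -((1 + s) ^ (-k) / k))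
      ((1 + |s|) ^ (-(1 + k))) s := by
    intro s hs
    rw [uIcc_of_le hT] at hs
    have := (((hasDerivAt_id s).const_add 1).rpow_const (p := -k)
      (Or.inl (by simp only [id]; linarith [hs.1]))).div_const k |>.fun_neg
    convert! this using 1
    rw [abs_of_nonneg hs.1]
    simp only [id]
    field_simp
    ring_nf
  rw [powInt, intervalIntegral.integral_eq_sub_of_hasDerivAt hd (intervalIntegrable_pow _ _ _)]
  simp
  ring

theorem powInt_zero {T : ℝ} (hT : 0 ≤ T) : powInt 0 T = Real.log (1 + T) := by
  have hd : ∀ s ∈ uIcc 0 T, HasDerivAt (fun s : ℝ => Real.log (1 + s))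
      ((1 + |s|) ^ (-(1 + 0) : ℝ)) s := by
    intro s hs
    rw [uIcc_of_le hT] at hs
    have := ((hasDerivAt_id s).const_add 1).log (by simp only [id]; linarith [hs.1])
    convert! this using 1
    rw [abs_of_nonneg hs.1, add_zero, Real.rpow_neg_one]
    simp
  rw [powInt, intervalIntegral.integral_eq_sub_of_hasDerivAt hd (intervalIntegrable_pow _ _ _)]
  simp

theorem powInt_le_of_pos {k T : ℝ} (hk : 0 < k) (hT : 0 ≤ T) : powInt k T ≤ 1 / k := by
  rw [powInt_eq_of_ne_zero hk.ne' hT]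
  have : 0 ≤ (1 + T) ^ (-k) := by positivity
  gcongr
  linarith

theorem powInt_le_of_neg {k T : ℝ} (hk : k < 0) (hT : 0 ≤ T) :
    powInt k T ≤ (1 + T) ^ (-k) / (-k) := by
  rw [powInt_eq_of_ne_zero hk.ne hT, ← neg_div_neg_eq]
  have : 0 < -k := by linarith
  gcongr
  linarith

/-- Half of `∫_0^T (1+s)^{-(1+a)} ∫_{|y|≤s+R} (1+|(s-|y|)|)^{-(1+b)} dy ds`. -/
noncomputable def coneInt (a b R T : ℝ) : ℝ :=
  ∫ s in (0 : ℝ)..T, (1 + |s|) ^ (-(1 + a)) * (powInt b s + powInt b R)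

/-! ### The a priori estimate -/

/-- A slice of the backward triangle need not lie in the cone supporting the source. Passing through
the integral over the whole line gives a bound uniform in the slice. -/
theorem abs_integral_le_of_support {φ k : ℝ → ℝ} {r α β : ℝ} (hφ : Continuous φ)
    (hk : Continuous k) (hr : 0 ≤ r) (hαβ : α ≤ β) (hb : ∀ y, |y| ≤ r → |φ y| ≤ k y)
    (h0 : ∀ y, r < |y| → φ y = 0) : |∫ y in α..β, φ y| ≤ ∫ y in (-r)..r, k y := by
  have h0' : ∀ y, y ∉ Icc (-r) r → |φ y| = 0 := fun y hy => by
    rw [h0 y (not_le.1 fun h => hy (abs_le.1 h)), abs_zero]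
  have hint : Integrable fun y => |φ y| :=
    hφ.abs.integrable_of_hasCompactSupport (HasCompactSupport.intro isCompact_Icc h0')
  calc |∫ y in α..β, φ y| ≤ ∫ y in α..β, |φ y| := intervalIntegral.abs_integral_le_integral_abs hαβ
    _ = ∫ y in Ioc α β, |φ y| := intervalIntegral.integral_of_le hαβ
    _ ≤ ∫ y, |φ y| := setIntegral_le_integral hint (Eventually.of_forall fun y => abs_nonneg _)
    _ = ∫ y in Icc (-r) r, |φ y| :=
        (setIntegral_eq_integral_of_forall_compl_eq_zero h0').symm
    _ = ∫ y in (-r)..r, |φ y| := by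
        rw [integral_Icc_eq_integral_Ioc, intervalIntegral.integral_of_le (by linarith)]
    _ ≤ ∫ y in (-r)..r, k y :=
        intervalIntegral.integral_mono_on (by linarith) (hφ.abs.intervalIntegrable _ _)
          (hk.intervalIntegrable _ _) fun y hy => hb y (abs_le.2 hy)

theorem duhamel_eq_zero_outside {h : ℝ × ℝ → ℝ} {R T x t : ℝ} (ht : t ∈ Icc 0 T)
    (h0 : ∀ y, ∀ s ∈ Icc 0 T, s + R < |y| → h (y, s) = 0) (hx : t + R < |x|) :
    duhamel h (x, t) = 0 := by
  rw [duhamel]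
  simp only
  rw [intervalIntegral.integral_congr (g := fun _ => 0), intervalIntegral.integral_zero, mul_zero]
  intro s hs
  rw [uIcc_of_le ht.1] at hs
  simp only
  rw [intervalIntegral.integral_congr (g := fun _ => 0), intervalIntegral.integral_zero]
  intro y hy
  rw [uIcc_of_le (by linarith [hs.2])] at hy
  refine h0 y s ⟨hs.1, hs.2.trans ht.2⟩ ?_
  rcases lt_abs.1 hx with hx | hx
  · exact lt_abs.2 (Or.inl (by linarith [hy.1]))
  · exact lt_abs.2 (Or.inr (by linarith [hy.2]))

theorem add_rpow_le {p x y : ℝ} (hp : 0 ≤ p) (hx : 0 ≤ x) (hy : 0 ≤ y) :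
    (x + y) ^ p ≤ 2 ^ p * (x ^ p + y ^ p) := by
  have h1 : x + y ≤ 2 * max x y := by linarith [le_max_left x y, le_max_right x y]
  have h2 : (max x y) ^ p ≤ x ^ p + y ^ p := by
    rcases max_choice x y with h | h <;> rw [h]
    · linarith [Real.rpow_nonneg hy p]
    · linarith [Real.rpow_nonneg hx p]
  calc (x + y) ^ p ≤ (2 * max x y) ^ p := Real.rpow_le_rpow (by positivity) h1 hp
    _ = 2 ^ p * (max x y) ^ p := Real.mul_rpow two_pos.le (hx.trans (le_max_left _ _))
    _ ≤ _ := by gcongr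

/-- `C` is a constant in the a priori estimate of `duhamel h`, for sources `|h| ≤ F |φ + v|^p` where
`|φ| ≤ N` lives in `|t - |x|| ≤ R` and `|v| ≤ D` lives in `|x| ≤ t + R`. -/
def IsDuhamelBound (p a b R C : ℝ) : Prop :=
  ∀ (h φ v : ℝ × ℝ → ℝ) (N D T : ℝ), Continuous h → 0 ≤ N → 0 ≤ D →
    (∀ y, ∀ s ∈ Icc 0 T, |φ (y, s)| ≤ N) →
    (∀ y, ∀ s ∈ Icc 0 T, R < |(s - |y|)| → φ (y, s) = 0) →
    (∀ y, ∀ s ∈ Icc 0 T, |v (y, s)| ≤ D) →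
    (∀ y, ∀ s ∈ Icc 0 T, s + R < |y| → v (y, s) = 0) →
    (∀ y, ∀ s ∈ Icc 0 T, |h (y, s)| ≤ weight a b y s * |φ (y, s) + v (y, s)| ^ p) →
    ∀ x, ∀ t ∈ Icc 0 T, |duhamel h (x, t)| ≤ C * (D ^ p * coneInt a b R T + N ^ p * powInt a T)

/-- Split `|φ + v|^p`. On the support of `φ` all powers of `1 + |s - |y||` are comparable, so the
exponent `-(1+b)` may be traded for the integrable `-2`; the slice integral is then bounded and only
`powInt a T` remains. The `v` part keeps its exponent and produces `coneInt`. -/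
theorem exists_isDuhamelBound (p a b R : ℝ) (hp : 0 < p) (hR : 0 ≤ R) :
    ∃ C > 0, IsDuhamelBound p a b R C := by
  set C₀ : ℝ := (2 + R) ^ |-(1 + a)| * 4 ^ |-(1 + b)| with hC₀
  -- `C₁` is the price of replacing the exponent `-(1+b)` by `-2` where `|s - |y|| ≤ R`.
  set C₁ : ℝ := (1 + R) ^ |1 - b| with hC₁
  have hC₀p : 0 < C₀ := by positivity
  have hC₁p : 0 < C₁ := by positivity
  refine ⟨2 ^ p * C₀ * (1 + 2 * C₁), by positivity, ?_⟩
  intro h φ v N D T hh hN hD hφ hφ0 hv hv0 hhb x t ht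
  have hT : 0 ≤ T := ht.1.trans ht.2
  have hh0 : ∀ y, ∀ s ∈ Icc 0 T, s + R < |y| → h (y, s) = 0 := by
    intro y s hs hy
    have e : φ (y, s) + v (y, s) = 0 := by
      rw [hv0 y s hs hy, hφ0 y s hs, add_zero]
      rw [abs_sub_comm]
      exact lt_abs.2 (Or.inl (by linarith))
    have := hhb y s hs
    rw [e, abs_zero, Real.zero_rpow hp.ne', mul_zero] at this
    exact abs_nonpos_iff.1 this
  have hpt : ∀ y, ∀ s ∈ Icc 0 T, |y| ≤ s + R → |h (y, s)| ≤ 2 ^ p * C₀ * (1 + |s|) ^ (-(1 + a)) *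
      (D ^ p * (1 + |(s - |y|)|) ^ (-(1 + b)) + N ^ p * C₁ * (1 + |(s - |y|)|) ^ (-(1 + 1) : ℝ)) := by
    intro y s hs hy
    have hw := weight_le (a := a) (b := b) hR hs.1 hy
    have hβ : 0 < 1 + |(s - |y|)| := by positivity
    have key : (1 + |(s - |y|)|) ^ (-(1 + b)) * |φ (y, s) + v (y, s)| ^ p ≤ 2 ^ p *
        (D ^ p * (1 + |(s - |y|)|) ^ (-(1 + b)) + N ^ p * C₁ * (1 + |(s - |y|)|) ^ (-(1 + 1) : ℝ)) := by
      have hsum : |φ (y, s) + v (y, s)| ^ p ≤ 2 ^ p * (|φ (y, s)| ^ p + D ^ p) :=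
        (Real.rpow_le_rpow (abs_nonneg _) ((abs_add_le _ _).trans
          (add_le_add_right (hv y s hs) _)) hp.le).trans (add_rpow_le hp.le (abs_nonneg _) hD)
      have hφN : (1 + |(s - |y|)|) ^ (-(1 + b)) * |φ (y, s)| ^ p ≤
          N ^ p * C₁ * (1 + |(s - |y|)|) ^ (-(1 + 1) : ℝ) := by
        rcases lt_or_ge R |(s - |y|)| with hlt | hle
        · rw [hφ0 y s hs hlt, abs_zero, Real.zero_rpow hp.ne', mul_zero]
          positivity
        · have e₁ : (1 + |(s - |y|)|) ^ (-(1 + b)) =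
              (1 + |(s - |y|)|) ^ (1 - b) * (1 + |(s - |y|)|) ^ (-(1 + 1) : ℝ) := by
            rw [← Real.rpow_add hβ]; ring_nf
          have e₂ : (1 + |(s - |y|)|) ^ (1 - b) ≤ C₁ := by
            simpa using rpow_le_of_comparable (r := 1 - b) (c := 1 + R) (x := 1) one_pos
              (by linarith) (by nlinarith [abs_nonneg (s - |y|)]) (by linarith : 1 + |(s - |y|)| ≤ _)
          have e₃ : |φ (y, s)| ^ p ≤ N ^ p := Real.rpow_le_rpow (abs_nonneg _) (hφ y s hs) hp.le
          calc _ ≤ C₁ * (1 + |(s - |y|)|) ^ (-(1 + 1) : ℝ) * N ^ p := by rw [e₁]; gcongr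
            _ = _ := by ring
      calc _ ≤ (1 + |(s - |y|)|) ^ (-(1 + b)) * (2 ^ p * (|φ (y, s)| ^ p + D ^ p)) := by gcongr
        _ = 2 ^ p * (D ^ p * (1 + |(s - |y|)|) ^ (-(1 + b)) +
            (1 + |(s - |y|)|) ^ (-(1 + b)) * |φ (y, s)| ^ p) := by ring
        _ ≤ _ := by gcongr
    calc |h (y, s)| ≤ weight a b y s * |φ (y, s) + v (y, s)| ^ p := hhb y s hs
      _ ≤ C₀ * ((1 + |s|) ^ (-(1 + a)) * (1 + |(s - |y|)|) ^ (-(1 + b))) *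
          |φ (y, s) + v (y, s)| ^ p := by gcongr
      _ = C₀ * (1 + |s|) ^ (-(1 + a)) *
          ((1 + |(s - |y|)|) ^ (-(1 + b)) * |φ (y, s) + v (y, s)| ^ p) := by ring
      _ ≤ C₀ * (1 + |s|) ^ (-(1 + a)) * (2 ^ p * (D ^ p * (1 + |(s - |y|)|) ^ (-(1 + b)) +
          N ^ p * C₁ * (1 + |(s - |y|)|) ^ (-(1 + 1) : ℝ))) := by gcongr
      _ = _ := by ring
  have hc₁ := continuous_one_add_abs_rpow continuous_id (-(1 + a))
  have hcE := continuous_powInt b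
  -- The `4` bounds `2 (powInt 1 s + powInt 1 R)`, each term being at most one.
  let κ : ℝ → ℝ := fun s => 2 ^ p * C₀ * (1 + |s|) ^ (-(1 + a)) *
    (D ^ p * (2 * (powInt b s + powInt b R)) + N ^ p * C₁ * 4)
  have hκ : Continuous κ := by
    simp only [id] at hc₁
    fun_prop
  have hinner : ∀ s ∈ Icc 0 t, |∫ y in (x - (t - s))..(x + (t - s)), h (y, s)| ≤ κ s := by
    intro s hs
    have hsT : s ∈ Icc 0 T := ⟨hs.1, hs.2.trans ht.2⟩
    have c : ∀ k : ℝ, Continuous fun y : ℝ => (1 + |(s - |y|)|) ^ (-(1 + k)) := fun k =>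
      continuous_one_add_abs_rpow (by fun_prop) _
    have cb := c b
    have c1 := c 1
    refine (abs_integral_le_of_support (r := s + R)
      (k := fun y => 2 ^ p * C₀ * (1 + |s|) ^ (-(1 + a)) *
      (D ^ p * (1 + |(s - |y|)|) ^ (-(1 + b)) + N ^ p * C₁ * (1 + |(s - |y|)|) ^ (-(1 + 1) : ℝ)))
      (by fun_prop) (by fun_prop) (by linarith [hs.1]) (by linarith [hs.2])
      (fun y hy => hpt y s hsT hy) (fun y hy => hh0 y s hsT hy)).trans ?_
    rw [intervalIntegral.integral_const_mul, intervalIntegral.integral_add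
      ((cb.const_mul _).intervalIntegrable _ _) ((c1.const_mul _).intervalIntegrable _ _),
      intervalIntegral.integral_const_mul, intervalIntegral.integral_const_mul,
      integral_cone_slice (by linarith [hs.1]), integral_cone_slice (by linarith [hs.1])]
    have l₁ := powInt_le_of_pos (k := 1) one_pos hs.1
    have l₂ := powInt_le_of_pos (k := 1) one_pos hR
    simp only [κ]
    gcongr
    linarith
  have hmid : |∫ s in (0 : ℝ)..t, ∫ y in (x - (t - s))..(x + (t - s)), h (y, s)| ≤
      ∫ s in (0 : ℝ)..T, κ s := by
    refine (intervalIntegral.abs_integral_le_integral_abs ht.1).trans ?_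
    refine (intervalIntegral.integral_mono_on ht.1
      ((continuous_integral_section hh (by fun_prop) (by fun_prop)).abs.intervalIntegrable _ _)
      (hκ.intervalIntegrable _ _) hinner).trans ?_
    refine intervalIntegral.integral_mono_interval le_rfl ht.1 ht.2 ?_ (hκ.intervalIntegrable _ _)
    refine ae_restrict_of_forall_mem measurableSet_Ioc fun s hs => ?_
    have := powInt_nonneg (k := b) hs.1.le
    have := powInt_nonneg (k := b) hR
    simp only [κ, Pi.zero_apply]
    positivity
  have hval : ∫ s in (0 : ℝ)..T, κ s = 2 ^ p * C₀ * D ^ p * 2 * coneInt a b R T +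
      2 ^ p * C₀ * N ^ p * C₁ * 4 * powInt a T := by
    simp only [id] at hc₁
    rw [coneInt, show powInt a T = ∫ s in (0 : ℝ)..T, (1 + |s|) ^ (-(1 + a)) from rfl, ← intervalIntegral.integral_const_mul,
      ← intervalIntegral.integral_const_mul, ← intervalIntegral.integral_add]
    · refine intervalIntegral.integral_congr fun s _ => ?_
      simp only [κ]
      ring
    · exact (by fun_prop : Continuous fun s => 2 ^ p * C₀ * D ^ p * 2 *
        ((1 + |s|) ^ (-(1 + a)) * (powInt b s + powInt b R))).intervalIntegrable _ _
    · exact (by fun_prop : Continuous fun s : ℝ => 2 ^ p * C₀ * N ^ p * C₁ * 4 *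
        (1 + |s|) ^ (-(1 + a))).intervalIntegrable _ _
  have hI : 0 ≤ coneInt a b R T := intervalIntegral.integral_nonneg hT fun s hs => by
    have := powInt_nonneg (k := b) hs.1
    have := powInt_nonneg (k := b) hR
    positivity
  have hE := powInt_nonneg (k := a) hT
  rw [hval] at hmid
  rw [duhamel, abs_mul, abs_of_pos (by norm_num : (0 : ℝ) < 1 / 2)]
  have q₁ : 0 ≤ 2 ^ p * C₀ * (2 * C₁ * (D ^ p * coneInt a b R T)) := by positivity
  have q₂ : 0 ≤ 2 ^ p * C₀ * (N ^ p * powInt a T) := by positivity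
  simp only
  calc _ ≤ 1 / 2 * (2 ^ p * C₀ * D ^ p * 2 * coneInt a b R T +
      2 ^ p * C₀ * N ^ p * C₁ * 4 * powInt a T) := by gcongr
    _ ≤ _ := by linarith

/-! ### The lifespan -/

theorem coneInt_le {a b R T : ℝ} {g : ℝ → ℝ} (hT : 0 ≤ T) (hg : ContinuousOn g (Icc 0 T))
    (h : ∀ s ∈ Icc 0 T, powInt b s + powInt b R ≤ g s) :
    coneInt a b R T ≤ ∫ s in (0 : ℝ)..T, (1 + |s|) ^ (-(1 + a)) * g s := by
  have hc : Continuous fun s : ℝ => (1 + |s|) ^ (-(1 + a)) :=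
    continuous_one_add_abs_rpow continuous_id _
  have hp := continuous_powInt b
  refine intervalIntegral.integral_mono_on hT
    ((by fun_prop : Continuous fun s : ℝ => (1 + |s|) ^ (-(1 + a)) * (powInt b s + powInt b R)
      ).intervalIntegrable _ _) ?_ fun s hs => ?_
  · refine ContinuousOn.intervalIntegrable ?_
    rw [uIcc_of_le hT]
    exact hc.continuousOn.mul hg
  · exact mul_le_mul_of_nonneg_left (h s hs) (by positivity)

theorem log_two_pos_le {T : ℝ} (hT : 0 ≤ T) : Real.log 2 ≤ Real.log (2 + T) :=
  Real.log_le_log two_pos (by linarith)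

theorem log_two_add_pos {T : ℝ} (hT : 0 ≤ T) : 0 < Real.log (2 + T) :=
  Real.log_pos (by linarith)

theorem powInt_zero_le {T : ℝ} (hT : 0 ≤ T) : powInt 0 T ≤ Real.log (2 + T) := by
  rw [powInt_zero hT]
  exact Real.log_le_log (by linarith) (by linarith)

theorem coneInt_le_of_pos {a b R T : ℝ} (hb : 0 < b) (hR : 0 ≤ R) (hT : 0 ≤ T) :
    coneInt a b R T ≤ 2 / b * powInt a T := by
  refine (coneInt_le (g := fun _ => 2 / b) hT continuousOn_const fun s hs => ?_).trans_eq ?_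
  · have h1 := powInt_le_of_pos hb hs.1
    have h2 := powInt_le_of_pos hb hR
    have : 2 / b = 1 / b + 1 / b := by ring
    linarith
  · rw [intervalIntegral.integral_mul_const, powInt, mul_comm]

theorem coneInt_le_of_zero {R : ℝ} (hR : 0 ≤ R) :
    ∃ C > 0, ∀ a T : ℝ, 0 ≤ T → coneInt a 0 R T ≤ C * (Real.log (2 + T) * powInt a T) := by
  have hl2 : 0 < Real.log 2 := Real.log_pos one_lt_two
  have hR' := powInt_nonneg (k := 0) hR
  refine ⟨1 + powInt 0 R / Real.log 2, by positivity, fun a T hT => ?_⟩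
  refine (coneInt_le (g := fun _ => (1 + powInt 0 R / Real.log 2) * Real.log (2 + T)) hT
    continuousOn_const fun s hs => ?_).trans_eq ?_
  · have h1 := powInt_zero_le hs.1
    have h2 : Real.log (2 + s) ≤ Real.log (2 + T) :=
      Real.log_le_log (by linarith [hs.1]) (by linarith [hs.2])
    have h3 : powInt 0 R ≤ powInt 0 R / Real.log 2 * Real.log (2 + T) := by
      rw [div_mul_eq_mul_div, le_div_iff₀ hl2]
      exact mul_le_mul_of_nonneg_left (log_two_pos_le hT) hR'
    linarith
  · rw [intervalIntegral.integral_mul_const,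
      show powInt a T = ∫ s in (0 : ℝ)..T, (1 + |s|) ^ (-(1 + a)) from rfl]
    ring

/-- For `b < 0` the slice grows like `(1+s)^{-b} ≥ 1`, which absorbs the constant `powInt b R` and
shifts the time exponent from `a` to `a + b`. -/
theorem coneInt_le_of_neg {b R : ℝ} (hb : b < 0) (hR : 0 ≤ R) :
    ∃ C > 0, ∀ a T : ℝ, 0 ≤ T → coneInt a b R T ≤ C * powInt (a + b) T := by
  have hb' : 0 < -b := by linarith
  have hR' := powInt_nonneg (k := b) hR
  refine ⟨1 / (-b) + powInt b R, by positivity, fun a T hT => ?_⟩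
  refine (coneInt_le (g := fun s => (1 / (-b) + powInt b R) * (1 + |s|) ^ (-b)) hT
    (continuous_const.mul (continuous_one_add_abs_rpow continuous_id _)).continuousOn
    fun s hs => ?_).trans_eq ?_
  · have h1 := powInt_le_of_neg hb hs.1
    have h2 : 1 ≤ (1 + s) ^ (-b) := Real.one_le_rpow (by linarith [hs.1]) hb'.le
    rw [abs_of_nonneg hs.1, add_mul, div_mul_eq_mul_div, one_mul]
    nlinarith
  · rw [show powInt (a + b) T = ∫ s in (0 : ℝ)..T, (1 + |s|) ^ (-(1 + (a + b))) from rfl,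
      ← intervalIntegral.integral_const_mul]
    refine intervalIntegral.integral_congr fun s _ => ?_
    have : (1 + |s|) ^ (-(1 + (a + b))) = (1 + |s|) ^ (-(1 + a)) * (1 + |s|) ^ (-b) := by
      rw [← Real.rpow_add (by positivity)]; ring_nf
    simp only [this]
    ring

theorem rpow_mul_le_of_le {q A I c d Y W : ℝ} (hq : 0 ≤ q) (hA : 0 ≤ A) (hAY : A ≤ c * Y)
    (hIW : I ≤ d * W) (hc : 0 ≤ c) (hY : 0 ≤ Y) (hdW : 0 ≤ d * W) :
    A ^ q * I ≤ c ^ q * d * (Y ^ q * W) := by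
  calc A ^ q * I ≤ (c * Y) ^ q * (d * W) := by
        have := Real.rpow_le_rpow hA hAY hq
        have := Real.rpow_nonneg hA q
        exact (mul_le_mul_of_nonneg_left hIW this).trans (by gcongr)
    _ = _ := by rw [Real.mul_rpow hc hY]; ring

/-- As `P = κ q`, it suffices that `ε^κ Z` is small. The summand `2` leaves room for replacing `T`
by `1 + T` or by `log (2 + T)`. -/
theorem exists_small_of_le_add {P κ q C η : ℝ} (hκ : 0 < κ) (hq : 0 < q) (hP : κ * q = P)
    (hC : 0 < C) (hη : 0 < η) :
    ∃ ε₃ > 0, ∃ c > 0, ∀ ε : ℝ, 0 < ε → ε ≤ ε₃ → ∀ Z : ℝ, 0 ≤ Z → Z ≤ 2 + c * ε ^ (-κ) →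
      ε ^ P * (C * Z ^ q) ≤ η := by
  obtain ⟨δ, hδ, hδ'⟩ : ∃ δ > 0, δ ^ q = η / C :=
    ⟨(η / C) ^ (1 / q), by positivity, by
      rw [← Real.rpow_mul (by positivity), one_div_mul_cancel hq.ne', Real.rpow_one]⟩
  -- Then `ε^κ Z ≤ 2 ε^κ + c ≤ δ/2 + δ/2`.
  refine ⟨(δ / 4) ^ (1 / κ), by positivity, δ / 2, by positivity, fun ε hε hle Z hZ hZle => ?_⟩
  have h1 : ε ^ κ ≤ δ / 4 := by
    have := Real.rpow_le_rpow hε.le hle hκ.le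
    rwa [← Real.rpow_mul (by positivity), one_div_mul_cancel hκ.ne', Real.rpow_one] at this
  have hεκ : 0 < ε ^ κ := by positivity
  have h2 : ε ^ κ * ε ^ (-κ) = 1 := by rw [← Real.rpow_add hε]; simp
  have h3 : ε ^ κ * Z ≤ δ := by
    have := mul_le_mul_of_nonneg_left hZle hεκ.le
    nlinarith
  have h4 := Real.rpow_le_rpow (by positivity) h3 hq.le
  rw [hδ', Real.mul_rpow hεκ.le hZ, ← Real.rpow_mul hε.le, hP, le_div_iff₀ hC] at h4
  linarith

theorem exists_small_of_log {P κ q C η : ℝ} (hκ : 0 < κ) (hq : 0 < q) (hP : κ * q = P)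
    (hC : 0 < C) (hη : 0 < η) :
    ∃ ε₃ > 0, ∃ c > 0, ∀ ε : ℝ, 0 < ε → ε ≤ ε₃ → ∀ T : ℝ, 0 < T →
      T ≤ Real.exp (c * ε ^ (-κ)) → ε ^ P * (C * Real.log (2 + T) ^ q) ≤ η := by
  obtain ⟨ε₃, hε₃, c, hc, H⟩ := exists_small_of_le_add hκ hq hP hC hη
  refine ⟨ε₃, hε₃, c, hc, fun ε hε hle T hT hTle => H ε hε hle _ (log_two_add_pos hT.le).le ?_⟩
  have hy : 0 ≤ c * ε ^ (-κ) := by positivity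
  -- The logarithm of the factor `3` is at most `2`, the allowed offset.
  have h1 : 2 + T ≤ 3 * Real.exp (c * ε ^ (-κ)) := by linarith [Real.one_le_exp hy]
  have h2 := Real.log_le_log (by linarith) h1
  rw [Real.log_mul (by norm_num) (Real.exp_pos _).ne', Real.log_exp] at h2
  linarith [Real.log_le_sub_one_of_pos (by norm_num : (0 : ℝ) < 3)]

theorem exists_small_of_pow {P κ q C η : ℝ} (hκ : 0 < κ) (hq : 0 < q) (hP : κ * q = P)
    (hC : 0 < C) (hη : 0 < η) :
    ∃ ε₃ > 0, ∃ c > 0, ∀ ε : ℝ, 0 < ε → ε ≤ ε₃ → ∀ T : ℝ, 0 < T →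
      T ≤ c * ε ^ (-κ) → ε ^ P * (C * (1 + T) ^ q) ≤ η := by
  obtain ⟨ε₃, hε₃, c, hc, H⟩ := exists_small_of_le_add hκ hq hP hC hη
  exact ⟨ε₃, hε₃, c, hc, fun ε hε hle T hT hTle => H ε hε hle _ (by linarith) (by linarith)⟩

/-- The hypothesis controls `T^q` but the estimate needs `(1+T)^q`: these are comparable for `T ≥
1`, and for `T ≤ 1` everything is bounded. -/
theorem exists_small_of_psi {P q r C η : ℝ} (hP : 0 < P) (hq : 0 < q) (hr : 0 ≤ r)
    (hC : 0 < C) (hη : 0 < η) :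
    ∃ ε₃ > 0, ∃ c > 0, ∀ ε : ℝ, 0 < ε → ε ≤ ε₃ → ∀ T : ℝ, 0 < T →
      T ^ q * Real.log (2 + T) ^ r ≤ c * ε ^ (-P) →
        ε ^ P * (C * ((1 + T) ^ q * Real.log (2 + T) ^ r)) ≤ η := by
  obtain ⟨ε₃, hε₃, c, hc, H⟩ := exists_small_of_le_add (κ := P) (q := 1) hP one_pos (mul_one P)
    (by positivity : 0 < C * (2 ^ q * 2 ^ r)) hη
  refine ⟨ε₃, hε₃, c, hc, fun ε hε hle T hT hTle => ?_⟩
  have hl := log_two_add_pos hT.le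
  have h2r : (1 : ℝ) ≤ 2 ^ r := Real.one_le_rpow one_le_two hr
  have h := H ε hε hle (2 + c * ε ^ (-P)) (by positivity) le_rfl
  rw [Real.rpow_one] at h
  refine le_trans ?_ h
  have key : (1 + T) ^ q * Real.log (2 + T) ^ r ≤ 2 ^ q * 2 ^ r * (2 + c * ε ^ (-P)) := by
    rcases le_total T 1 with hT1 | hT1
    · have h1 : (1 + T) ^ q ≤ 2 ^ q := Real.rpow_le_rpow (by linarith) (by linarith) hq.le
      have h2 : Real.log (2 + T) ^ r ≤ 2 ^ r := by
        refine Real.rpow_le_rpow hl.le ?_ hr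
        linarith [Real.log_le_sub_one_of_pos (by linarith : 0 < 2 + T)]
      have : 0 ≤ c * ε ^ (-P) := by positivity
      calc _ ≤ (2 : ℝ) ^ q * 2 ^ r := by gcongr
        _ ≤ _ := le_mul_of_one_le_right (by positivity) (by linarith)
    · have h1 : (1 + T) ^ q ≤ 2 ^ q * T ^ q := by
        rw [← Real.mul_rpow two_pos.le hT.le]
        exact Real.rpow_le_rpow (by linarith) (by linarith) hq.le
      calc _ ≤ 2 ^ q * T ^ q * Real.log (2 + T) ^ r := by gcongr
        _ = 2 ^ q * (T ^ q * Real.log (2 + T) ^ r) := by ring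
        _ ≤ 2 ^ q * (2 ^ r * (2 + c * ε ^ (-P))) := by
          have : 0 ≤ c * ε ^ (-P) := by positivity
          refine mul_le_mul_of_nonneg_left (hTle.trans ?_) (by positivity)
          nlinarith
        _ = _ := by ring
  calc _ ≤ ε ^ P * (C * (2 ^ q * 2 ^ r * (2 + c * ε ^ (-P)))) := by gcongr
    _ = _ := by ring

theorem psi_le_of_le_inv {ψ : ℝ → ℝ} {q r : ℝ} (hψ : ∀ s, ψ s = s ^ q * Real.log (2 + s) ^ r)
    (hq : 0 ≤ q) (hr : 0 ≤ r) (hbij : BijOn ψ (Ici 0) (Ici 0)) {T y : ℝ} (hT : 0 < T) (hy : 0 ≤ y)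
    (h : T ≤ Function.invFunOn ψ (Ici 0) y) : T ^ q * Real.log (2 + T) ^ r ≤ y := by
  have e : ψ (Function.invFunOn ψ (Ici 0) y) = y := hbij.invOn_invFunOn.2 hy
  rw [← e, hψ]
  have hS := hT.le.trans h
  have hl := log_two_add_pos hT.le
  gcongr

/-- Up to constants, `E = powInt a T` is at most `(1+T)^{-a}`, `log(2+T)` or `1` for `a < 0`, `a =
0`, `a > 0`. `I` is at most `E` for `b > 0`, `E log(2+T)` for `b = 0`, and `powInt (a+b) T` for `b <
0`. The growth of `E^{p-1} I` dictates each lifespan. -/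
theorem exists_lifespan_small {p a b R η : ℝ} (hp : 1 < p) (hR : 0 ≤ R) (hη : 0 < η) :
    ∃ ε₃ > 0, ∃ c > 0, ∀ ε : ℝ, 0 < ε → ε ≤ ε₃ → ∀ T : ℝ, 0 < T →
      BelowLifespanBound p a b c ε T →
        ε ^ (p * (p - 1)) * (powInt a T ^ (p - 1) * coneInt a b R T) ≤ η := by
  have hp1 : 0 < p - 1 := by linarith
  have hP : 0 < p * (p - 1) := by positivity
  rcases lt_trichotomy a 0 with ha | rfl | ha
  · have hA : ∀ T : ℝ, 0 ≤ T → powInt a T ≤ 1 / (-a) * (1 + T) ^ (-a) := fun T hT =>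
      (powInt_le_of_neg ha hT).trans_eq (by ring)
    have ha' : 0 < -a := by linarith
    have hpa : 0 < -(p * a) := by nlinarith
    have hX : ∀ T : ℝ, 0 < T → ∀ q : ℝ, ((1 + T) ^ (-a)) ^ (p - 1) * (1 + T) ^ q =
        (1 + T) ^ (-(p * a) + (a + q)) := fun T hT q => by
      rw [← Real.rpow_mul (by positivity), ← Real.rpow_add (by positivity)]; ring_nf
    rcases lt_trichotomy b 0 with hb | rfl | hb
    · obtain ⟨C, hC, hI⟩ := coneInt_le_of_neg hb hR
      have hab : 0 < -(a + b) := by linarith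
      obtain ⟨ε₃, hε₃, c, hc, H⟩ := exists_small_of_pow (P := p * (p - 1))
        (κ := p * (p - 1) / (-(p * a) - b)) (q := -(p * a) - b)
        (C := (1 / (-a)) ^ (p - 1) * (C / (-(a + b)))) (div_pos hP (by linarith)) (by linarith)
        (div_mul_cancel₀ _ (by linarith)) (by positivity) hη
      refine ⟨ε₃, hε₃, c, hc, fun ε hε hle T hT h => ?_⟩
      have hT' : T ≤ c * ε ^ (-(p * (p - 1) / (-(p * a) - b))) := by
        -- The signs of `a` and `b` rule out all alternatives but one.
        rcases h with h | h | h | h | h | h | h | h <;>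
          first | exact h.2.2 | (exfalso; linarith [h.1, h.2.1])
      refine le_trans (mul_le_mul_of_nonneg_left ?_ (by positivity)) (H ε hε hle T hT hT')
      refine (rpow_mul_le_of_le (d := C / (-(a + b))) (W := (1 + T) ^ (-(a + b))) hp1.le (powInt_nonneg hT.le)
        (hA T hT.le) ?_ (by positivity) (by positivity) ?_).trans_eq
        (by rw [hX T hT]; ring_nf)
      · refine (hI a T hT.le).trans ?_
        refine (mul_le_mul_of_nonneg_left (powInt_le_of_neg (by linarith) hT.le) hC.le).trans_eq ?_
        ring
      · positivity
    · obtain ⟨C, hC, hI⟩ := coneInt_le_of_zero hR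
      obtain ⟨ε₃, hε₃, c, hc, H⟩ := exists_small_of_psi (P := p * (p - 1)) (q := -(p * a)) (r := 1)
        (C := (1 / (-a)) ^ (p - 1) * (C * (1 / (-a)))) hP hpa zero_le_one (by positivity) hη
      refine ⟨ε₃, hε₃, c, hc, fun ε hε hle T hT h => ?_⟩
      have hT' : T ≤ psi1Inv p a (c * ε ^ (-(p * (p - 1)))) := by
        rcases h with h | h | h | h | h | h | h | h <;>
          first | exact h.2.2 | (exfalso; linarith [h.1, h.2.1])
      have hψ := psi_le_of_le_inv (ψ := psi1 p a) (q := -(p * a)) (r := 1)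
        (fun s => by rw [psi1, Real.rpow_one]) hpa.le zero_le_one (psi1_bijOn (by linarith) ha) hT
        (by positivity) hT'
      refine le_trans (mul_le_mul_of_nonneg_left ?_ (by positivity)) (H ε hε hle T hT hψ)
      have hl := log_two_add_pos hT.le
      refine (rpow_mul_le_of_le (d := C * (1 / (-a))) (W := (1 + T) ^ (-a) * Real.log (2 + T)) hp1.le
        (powInt_nonneg hT.le) (hA T hT.le) ?_ (by positivity) (by positivity) ?_).trans_eq
        (by rw [← mul_assoc (((1 + T) ^ (-a)) ^ (p - 1)), hX T hT, Real.rpow_one]; ring_nf)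
      · refine (hI a T hT.le).trans ?_
        refine (mul_le_mul_of_nonneg_left (mul_le_mul_of_nonneg_left (hA T hT.le) hl.le)
          hC.le).trans_eq ?_
        ring
      · positivity
    · obtain ⟨ε₃, hε₃, c, hc, H⟩ := exists_small_of_pow (P := p * (p - 1))
        (κ := (p - 1) / (-a)) (q := -(p * a))
        (C := (1 / (-a)) ^ (p - 1) * (2 / b * (1 / (-a)))) (div_pos hp1 ha') hpa
        (by have := ha.ne; field_simp) (by positivity) hη
      refine ⟨ε₃, hε₃, c, hc, fun ε hε hle T hT h => ?_⟩
      have hT' : T ≤ c * ε ^ (-((p - 1) / (-a))) := by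
        rcases h with h | h | h | h | h | h | h | h <;>
          first | exact h.2.2 | (exfalso; linarith [h.1, h.2.1])
      refine le_trans (mul_le_mul_of_nonneg_left ?_ (by positivity)) (H ε hε hle T hT hT')
      refine (rpow_mul_le_of_le (d := 2 / b * (1 / (-a))) (W := (1 + T) ^ (-a)) hp1.le (powInt_nonneg hT.le)
        (hA T hT.le) ?_ (by positivity) (by positivity) ?_).trans_eq
        (by rw [hX T hT]; ring_nf)
      · refine (coneInt_le_of_pos hb hR hT.le).trans ?_
        refine (mul_le_mul_of_nonneg_left (hA T hT.le) (by positivity)).trans_eq ?_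
        ring
      · positivity
  · have hA : ∀ T : ℝ, 0 ≤ T → powInt 0 T ≤ 1 * Real.log (2 + T) := fun T hT => by
      rw [one_mul]; exact powInt_zero_le hT
    have hA' : ∀ T : ℝ, 0 ≤ T → powInt 0 T ≤ Real.log (2 + T) := fun T hT => powInt_zero_le hT
    rcases lt_trichotomy b 0 with hb | rfl | hb
    · obtain ⟨C, hC, hI⟩ := coneInt_le_of_neg hb hR
      have hb' : 0 < -b := by linarith
      obtain ⟨ε₃, hε₃, c, hc, H⟩ := exists_small_of_psi (P := p * (p - 1)) (q := -b) (r := p - 1)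
        (C := 1 ^ (p - 1) * (C / (-b))) hP hb' hp1.le (by positivity) hη
      refine ⟨ε₃, hε₃, c, hc, fun ε hε hle T hT h => ?_⟩
      have hT' : T ≤ psi2Inv p b (c * ε ^ (-(p * (p - 1)))) := by
        rcases h with h | h | h | h | h | h | h | h <;>
          first | exact h.2.2 | (exfalso; linarith [h.1, h.2.1])
      have hψ := psi_le_of_le_inv (ψ := psi2 p b) (fun s => rfl) hb'.le hp1.le
        (psi2_bijOn hp.le hb) hT (by positivity) hT'
      refine le_trans (mul_le_mul_of_nonneg_left ?_ (by positivity)) (H ε hε hle T hT hψ)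
      have hl := log_two_add_pos hT.le
      refine (rpow_mul_le_of_le (d := C / (-b)) (W := (1 + T) ^ (-b)) hp1.le
        (powInt_nonneg hT.le) (hA T hT.le) ?_ (by positivity) (by positivity) ?_).trans_eq
        (by ring_nf)
      · refine (hI 0 T hT.le).trans ?_
        rw [zero_add]
        refine (mul_le_mul_of_nonneg_left (powInt_le_of_neg hb hT.le) hC.le).trans_eq ?_
        ring
      · positivity
    · obtain ⟨C, hC, hI⟩ := coneInt_le_of_zero hR
      obtain ⟨ε₃, hε₃, c, hc, H⟩ := exists_small_of_log (P := p * (p - 1))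
        (κ := p * (p - 1) / (p + 1)) (q := p + 1)
        (C := 1 ^ (p - 1) * C) (div_pos hP (by linarith)) (by linarith)
        (div_mul_cancel₀ _ (by linarith)) (by positivity) hη
      refine ⟨ε₃, hε₃, c, hc, fun ε hε hle T hT h => ?_⟩
      have hT' : T ≤ Real.exp (c * ε ^ (-(p * (p - 1) / (p + 1)))) := by
        rcases h with h | h | h | h | h | h | h | h <;>
          first | exact h.2.2 | (exfalso; linarith [h.1, h.2.1])
      refine le_trans (mul_le_mul_of_nonneg_left ?_ (by positivity)) (H ε hε hle T hT hT')
      have hl := log_two_add_pos hT.le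
      refine (rpow_mul_le_of_le (d := C) (W := Real.log (2 + T) * Real.log (2 + T)) hp1.le
        (powInt_nonneg hT.le) (hA T hT.le) ?_ (by positivity) (by positivity) ?_).trans_eq ?_
      · refine (hI 0 T hT.le).trans ?_
        have := hA' T hT.le
        gcongr
      · positivity
      -- `p - 1` logarithms come from `E^{p-1}` and two from `coneInt`.
      · rw [show p + 1 = p - 1 + 1 + 1 by ring, Real.rpow_add_one hl.ne', Real.rpow_add_one hl.ne']
        ring
    · obtain ⟨ε₃, hε₃, c, hc, H⟩ := exists_small_of_log (P := p * (p - 1))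
        (κ := p - 1) (q := p) (C := 1 ^ (p - 1) * (2 / b)) hp1 (by linarith)
        (mul_comm _ _) (by positivity) hη
      refine ⟨ε₃, hε₃, c, hc, fun ε hε hle T hT h => ?_⟩
      have hT' : T ≤ Real.exp (c * ε ^ (-(p - 1))) := by
        rcases h with h | h | h | h | h | h | h | h <;>
          first | exact h.2.2 | (exfalso; linarith [h.1, h.2.1])
      refine le_trans (mul_le_mul_of_nonneg_left ?_ (by positivity)) (H ε hε hle T hT hT')
      have hl := log_two_add_pos hT.le
      refine (rpow_mul_le_of_le (d := 2 / b) (W := Real.log (2 + T)) hp1.le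
        (powInt_nonneg hT.le) (hA T hT.le) ?_ (by positivity) (by positivity) ?_).trans_eq ?_
      · refine (coneInt_le_of_pos hb hR hT.le).trans ?_
        have := hA' T hT.le
        gcongr
      · positivity
      · rw [← Real.rpow_add_one hl.ne', sub_add_cancel]
  · have hA : ∀ T : ℝ, 0 ≤ T → powInt a T ≤ 1 / a * 1 := fun T hT => by
      rw [mul_one]; exact powInt_le_of_pos ha hT
    rcases lt_trichotomy (a + b) 0 with hab | hab | hab
    · obtain ⟨C, hC, hI⟩ := coneInt_le_of_neg (by linarith : b < 0) hR
      have hab' : 0 < -(a + b) := by linarith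
      obtain ⟨ε₃, hε₃, c, hc, H⟩ := exists_small_of_pow (P := p * (p - 1))
        (κ := p * (p - 1) / (-a - b)) (q := -a - b)
        (C := (1 / a) ^ (p - 1) * (C / (-(a + b)))) (div_pos hP (by linarith)) (by linarith)
        (div_mul_cancel₀ _ (by linarith)) (by positivity) hη
      refine ⟨ε₃, hε₃, c, hc, fun ε hε hle T hT h => ?_⟩
      have hT' : T ≤ c * ε ^ (-(p * (p - 1) / (-a - b))) := by
        rcases h with h | h | h | h | h | h | h | h <;>
          first | exact h.2.2 | (exfalso; linarith [h.1, h.2.1])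
      refine le_trans (mul_le_mul_of_nonneg_left ?_ (by positivity)) (H ε hε hle T hT hT')
      refine (rpow_mul_le_of_le (d := C / (-(a + b))) (W := (1 + T) ^ (-(a + b))) hp1.le (powInt_nonneg hT.le)
        (hA T hT.le) ?_ (by positivity) zero_le_one ?_).trans_eq
        (by rw [Real.one_rpow, one_mul, neg_add'])
      · refine (hI a T hT.le).trans ?_
        refine (mul_le_mul_of_nonneg_left (powInt_le_of_neg (by linarith) hT.le) hC.le).trans_eq ?_
        ring
      · positivity
    · obtain ⟨C, hC, hI⟩ := coneInt_le_of_neg (by linarith : b < 0) hR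
      obtain ⟨ε₃, hε₃, c, hc, H⟩ := exists_small_of_log (P := p * (p - 1))
        (κ := p * (p - 1)) (q := 1) (C := (1 / a) ^ (p - 1) * C) hP one_pos
        (mul_one _) (by positivity) hη
      refine ⟨ε₃, hε₃, c, hc, fun ε hε hle T hT h => ?_⟩
      have hT' : T ≤ Real.exp (c * ε ^ (-(p * (p - 1)))) := by
        rcases h with h | h | h | h | h | h | h | h <;>
          first | exact h.2.2 | (exfalso; linarith [h.1, h.2.1])
      refine le_trans (mul_le_mul_of_nonneg_left ?_ (by positivity)) (H ε hε hle T hT hT')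
      have hl := log_two_add_pos hT.le
      refine (rpow_mul_le_of_le (d := C) (W := Real.log (2 + T)) hp1.le (powInt_nonneg hT.le)
        (hA T hT.le) ?_ (by positivity) zero_le_one ?_).trans_eq
        (by rw [Real.one_rpow, one_mul, Real.rpow_one])
      · refine (hI a T hT.le).trans ?_
        rw [hab]
        have := powInt_zero_le hT.le
        gcongr
      · positivity
    -- Here `a > 0` and `a + b > 0`: no alternative applies, so the constants are arbitrary.
    · refine ⟨1, one_pos, 1, one_pos, fun ε hε hle T hT h => ?_⟩
      exfalso
      rcases h with h | h | h | h | h | h | h | h <;> linarith [h.1, h.2.1]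

/-! ### Free waves -/

/-- d'Alembert's solution of `u_tt - u_xx = 0`, `u(x,0) = f(x)`, `u_t(x,0) = g(x)`. -/
noncomputable def freeWave (f g : ℝ → ℝ) (z : ℝ × ℝ) : ℝ :=
  (f (z.1 + z.2) + f (z.1 - z.2)) / 2 + (∫ y in (z.1 - z.2)..(z.1 + z.2), g y) / 2

theorem contDiff_two_primitive {g : ℝ → ℝ} (hg : ContDiff ℝ 1 g) :
    ContDiff ℝ 2 fun x => ∫ y in (0 : ℝ)..x, g y := by
  have hd : ∀ x, HasDerivAt (fun x => ∫ y in (0 : ℝ)..x, g y) (g x) x := fun x =>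
    hg.continuous.integral_hasStrictDerivAt 0 x |>.hasDerivAt
  have e : (2 : WithTop ℕ∞) = 1 + 1 := by norm_num
  rw [e, contDiff_succ_iff_deriv]
  refine ⟨fun x => (hd x).differentiableAt, by simp, ?_⟩
  rwa [funext fun x => (hd x).deriv]

theorem exists_freeWave_eq {f g : ℝ → ℝ} (hf : ContDiff ℝ 2 f) (hg : ContDiff ℝ 1 g) :
    ∃ A B : ℝ → ℝ, ContDiff ℝ 2 A ∧ ContDiff ℝ 2 B ∧
      ∀ x t, freeWave f g (x, t) = A (x + t) + B (x - t) := by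
  have hG := contDiff_two_primitive hg
  refine ⟨fun x => (f x + ∫ y in (0 : ℝ)..x, g y) / 2, fun x => (f x - ∫ y in (0 : ℝ)..x, g y) / 2,
    (hf.add hG).div_const 2, (hf.sub hG).div_const 2, fun x t => ?_⟩
  rw [freeWave, ← intervalIntegral.integral_interval_sub_left
    (hg.continuous.intervalIntegrable 0 _) (hg.continuous.intervalIntegrable 0 _)]
  ring

theorem contDiff_freeWave {f g : ℝ → ℝ} (hf : ContDiff ℝ 2 f) (hg : ContDiff ℝ 1 g) :
    ContDiff ℝ 2 (freeWave f g) := by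
  obtain ⟨A, B, hA, hB, h⟩ := exists_freeWave_eq hf hg
  rw [show freeWave f g = fun z => A (z.1 + z.2) + B (z.1 - z.2) from funext fun z => h z.1 z.2]
  exact (hA.comp (contDiff_fst.add contDiff_snd)).add (hB.comp (contDiff_fst.sub contDiff_snd))

theorem freeWave_wave {f g : ℝ → ℝ} (hf : ContDiff ℝ 2 f) (hg : ContDiff ℝ 1 g) (x t : ℝ) :
    iteratedDeriv 2 (fun s => freeWave f g (x, s)) t
      = iteratedDeriv 2 (fun y => freeWave f g (y, t)) x := by
  obtain ⟨A, B, hA, hB, h⟩ := exists_freeWave_eq hf hg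
  simp only [h]
  rw [iteratedDeriv_fun_add (by fun_prop) (by fun_prop),
    iteratedDeriv_fun_add (by fun_prop) (by fun_prop), iteratedDeriv_comp_const_add,
    iteratedDeriv_comp_const_sub, iteratedDeriv_comp_add_const, iteratedDeriv_comp_sub_const]
  simp

theorem freeWave_zero (f g : ℝ → ℝ) (x : ℝ) : freeWave f g (x, 0) = f x := by
  simp [freeWave]

theorem hasDerivAt_freeWave_zero {f g : ℝ → ℝ} (hf : ContDiff ℝ 2 f) (hg : ContDiff ℝ 1 g) (x : ℝ) :
    HasDerivAt (fun s => freeWave f g (x, s)) (g x) 0 := by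
  have hG : ∀ r, HasDerivAt (fun x => ∫ y in (0 : ℝ)..x, g y) (g r) r := fun r =>
    hg.continuous.integral_hasStrictDerivAt 0 r |>.hasDerivAt
  have hF : ∀ r, HasDerivAt f (deriv f r) r := fun r =>
    (hf.differentiable two_ne_zero r).hasDerivAt
  have hp : HasDerivAt (fun s => x + s) 1 0 := (hasDerivAt_id (0 : ℝ)).const_add x
  have hm : HasDerivAt (fun s => x - s) (-1) 0 := (hasDerivAt_id (0 : ℝ)).const_sub x
  have e : (fun s => freeWave f g (x, s)) = fun s => (f (x + s) + f (x - s)) / 2 +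
      ((∫ y in (0 : ℝ)..(x + s), g y) - ∫ y in (0 : ℝ)..(x - s), g y) / 2 := by
    ext s
    rw [freeWave, ← intervalIntegral.integral_interval_sub_left
      (hg.continuous.intervalIntegrable 0 _) (hg.continuous.intervalIntegrable 0 _)]
  rw [e]
  have h1 := (((hF (x + 0)).comp 0 hp).add ((hF (x - 0)).comp 0 hm)).div_const 2
  have h2 := (((hG (x + 0)).comp 0 hp).sub ((hG (x - 0)).comp 0 hm)).div_const 2
  convert! h1.add h2 using 1
  simp

/-- Strong Huygens principle. For `t - |x| > R` the interval of integration contains the support of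
`g`, and the integral vanishes by `∫ g = 0`; for `|x| - t > R` it misses the support. -/
theorem freeWave_eq_zero {f g : ℝ → ℝ} {R : ℝ} (hf : ∀ x, R < |x| → f x = 0)
    (hg : ∀ x, R < |x| → g x = 0) (hg0 : ∫ x, g x = 0) {x t : ℝ} (ht : 0 ≤ t)
    (h : R < |(t - |x|)|) : freeWave f g (x, t) = 0 := by
  have hpm : R < |x + t| ∧ R < |x - t| ∧ ∫ y in (x - t)..(x + t), g y = 0 := by
    rcases lt_abs.1 h with h | h
    · have h1 : R < x + t := by linarith [neg_abs_le x]
      have h2 : R < -(x - t) := by linarith [le_abs_self x]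
      refine ⟨lt_abs.2 (Or.inl h1), lt_abs.2 (Or.inr h2), ?_⟩
      rw [intervalIntegral.integral_eq_integral_of_support_subset, hg0]
      intro y hy
      by_contra hny
      apply hy
      apply hg
      rcases le_or_gt y (x - t) with hle | hlt
      · exact lt_abs.2 (Or.inr (by linarith))
      · have : x + t < y := not_le.1 fun h' => hny ⟨hlt, h'⟩
        exact lt_abs.2 (Or.inl (by linarith))
    · have h0 : ∀ y ∈ uIcc (x - t) (x + t), R < |y| := by
        intro y hy
        rw [uIcc_of_le (by linarith)] at hy
        rcases le_total 0 x with hx | hx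
        · rw [abs_of_nonneg hx] at h
          exact lt_abs.2 (Or.inl (by linarith [hy.1]))
        · rw [abs_of_nonpos hx] at h
          exact lt_abs.2 (Or.inr (by linarith [hy.2]))
      refine ⟨h0 _ right_mem_uIcc, h0 _ left_mem_uIcc, ?_⟩
      rw [intervalIntegral.integral_congr (g := fun _ => 0) fun y hy => hg y (h0 y hy),
        intervalIntegral.integral_zero]
  rw [freeWave]
  simp only [hf _ hpm.1, hf _ hpm.2.1, hpm.2.2]
  simp

theorem exists_freeWave_bound {f g : ℝ → ℝ} (hf : Continuous f) (hg : Continuous g)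
    (hfc : HasCompactSupport f) (hgc : HasCompactSupport g) :
    ∃ M > 0, ∀ z, |freeWave f g z| ≤ M := by
  obtain ⟨C, hC⟩ := hfc.exists_bound_of_continuous hf
  have hC0 : 0 ≤ C := (norm_nonneg _).trans (hC 0)
  have hI : 0 ≤ ∫ y, ‖g y‖ := integral_nonneg fun y => norm_nonneg _
  refine ⟨C + (∫ y, ‖g y‖) + 1, by positivity, fun z => ?_⟩
  have h3 : |∫ y in (z.1 - z.2)..(z.1 + z.2), g y| ≤ ∫ y, ‖g y‖ :=
    intervalIntegral.norm_integral_le_integral_norm_uIoc.trans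
      (setIntegral_le_integral (hg.integrable_of_hasCompactSupport hgc).norm
        (Eventually.of_forall fun y => norm_nonneg _))
  have h1 := abs_le.1 (hC (z.1 + z.2))
  have h2 := abs_le.1 (hC (z.1 - z.2))
  rw [abs_le] at h3 ⊢
  rw [freeWave]
  constructor <;> linarith [h1.1, h1.2, h2.1, h2.2, h3.1, h3.2]

/-! ### Existence -/

theorem contDiff_one_cutoff_rpow {p : ℝ} (hp : 1 < p) {θ : ℝ → ℝ} (hθ : ContDiff ℝ 1 θ) :
    ContDiff ℝ 1 fun q => θ q * |q| ^ p :=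
  hθ.mul (contDiff_norm_rpow hp)

/-- A solution of the integral equation for a source cut off in space-time and in the unknown. -/
theorem exists_truncated_solution {p : ℝ} (hp : 1 < p) {w u₀ χ : ℝ × ℝ → ℝ} {θ : ℝ → ℝ}
    (hw : ContDiff ℝ 1 w) (hu₀ : ContDiff ℝ 1 u₀) (hχ : ContDiff ℝ 1 χ) (hχc : HasCompactSupport χ)
    (hθ : ContDiff ℝ 1 θ) (hθc : HasCompactSupport θ) {Ω : Set (ℝ × ℝ)} {B : ℝ × ℝ → ℝ}
    (hB : ∀ z ∈ Ω, 0 ≤ B z)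
    (hinv : ∀ v : ℝ × ℝ → ℝ, Continuous v → (∀ z ∈ Ω, |v z| ≤ B z) →
      ∀ z ∈ Ω, |duhamel (fun z => χ z * w z * (θ (u₀ z + v z) * |u₀ z + v z| ^ p)) z| ≤ B z) :
    ∃ v h : ℝ × ℝ → ℝ, (∀ z, h z = χ z * w z * (θ (u₀ z + v z) * |u₀ z + v z| ^ p)) ∧
      ContDiff ℝ 1 h ∧ v = duhamel h ∧ ∀ z ∈ Ω, |v z| ≤ B z := by
  have hn := contDiff_one_cutoff_rpow hp hθ
  have hnc : HasCompactSupport fun q => θ q * |q| ^ p := hθc.mul_right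
  have hχw := hχ.mul hw
  have hχwc : HasCompactSupport fun z => χ z * w z := hχc.mul_right
  obtain ⟨C₁, hC₁⟩ := hχwc.exists_bound_of_continuous hχw.continuous
  obtain ⟨C₂, hC₂⟩ := hnc.exists_bound_of_continuous hn.continuous
  obtain ⟨Λ, hΛ⟩ := hn.lipschitzWith_of_hasCompactSupport hnc one_ne_zero
  have hC₁0 : 0 ≤ C₁ := (norm_nonneg _).trans (hC₁ 0)
  obtain ⟨v, hvc, hv, hvB⟩ := exists_duhamel_fixedPoint
    (m := fun z y => χ z * w z * (θ (u₀ z + y) * |u₀ z + y| ^ p)) (C := C₁ * C₂) (Λ := C₁ * Λ)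
    (by
      have h1 := hn.continuous.comp
        (by have := hu₀.continuous; fun_prop : Continuous fun q : (ℝ × ℝ) × ℝ => u₀ q.1 + q.2)
      exact (hχw.continuous.comp continuous_fst).mul h1)
    (fun z y => by
      rw [abs_mul]
      exact mul_le_mul (hC₁ z) (hC₂ (u₀ z + y)) (abs_nonneg _) hC₁0)
    (fun z y y' => by
      rw [← mul_sub, abs_mul, mul_assoc]
      refine mul_le_mul (hC₁ z) ?_ (abs_nonneg _) hC₁0
      simpa [Real.dist_eq] using hΛ.dist_le_mul (u₀ z + y) (u₀ z + y'))
    hB hinv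
  have hsrc : ∀ v : ℝ × ℝ → ℝ, ContDiff ℝ 1 v →
      ContDiff ℝ 1 fun z => χ z * w z * (θ (u₀ z + v z) * |u₀ z + v z| ^ p) :=
    fun v hv => hχw.mul (hn.comp (hu₀.add hv))
  -- Bootstrap: continuity of `v` makes the source continuous, hence `v` is `C¹`, hence the source
  -- is `C¹`.
  have hv1 : ContDiff ℝ 1 v := by
    rw [funext hv]
    refine contDiff_one_duhamel ?_
    exact hχw.continuous.mul (hn.continuous.comp (hu₀.continuous.add hvc))
  exact ⟨v, _, fun z => rfl, hsrc v hv1, funext hv, hvB⟩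

/-- Cutoffs with values in `[0,1]` only decrease the source, so the a priori estimate applies to the
truncated problem and keeps its solution in the region where truncation changes nothing. -/
theorem exists_classicalSolution {p a b R ε N D T C : ℝ} {f g : ℝ → ℝ} (hp : 1 < p) (hR : 0 ≤ R)
    (hf : ContDiff ℝ 2 f) (hg : ContDiff ℝ 1 g) (hN : 0 ≤ N) (hD : 0 ≤ D) (hT : 0 < T)
    (hφN : ∀ z, |ε * freeWave f g z| ≤ N)
    (hφ0 : ∀ y s, 0 ≤ s → R < |(s - |y|)| → freeWave f g (y, s) = 0)
    (hC : IsDuhamelBound p a b R C)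
    (hsmall : C * (D ^ p * coneInt a b R T + N ^ p * powInt a T) ≤ D) :
    ∃ u : ℝ → ℝ → ℝ, IsClassicalSolution p a b ε f g T u := by
  have hp0 : p ≠ 0 := by linarith
  -- In the sup norm the inner ball contains the cone `|x| ≤ t + R` up to time `T`; the inner radius
  -- of `θ` exceeds `N + D ≥ |ε u₀ + v|`.
  let χ : ContDiffBump (0 : ℝ × ℝ) := ⟨T + R + 1, T + R + 2, by linarith, by linarith⟩
  let θ : ContDiffBump (0 : ℝ) := ⟨N + D + 1, N + D + 2, by linarith, by linarith⟩
  have hW2 : ContDiff ℝ 2 fun z => ε * freeWave f g z := contDiff_const.mul (contDiff_freeWave hf hg)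
  let Ω : Set (ℝ × ℝ) := {z | z.2 ∈ Icc 0 T}
  -- One bound encodes both the size of `v` and its vanishing outside the cone.
  let B : ℝ × ℝ → ℝ := fun z => if z.2 + R < |z.1| then 0 else D
  have hw : ContDiff ℝ 1 fun z : ℝ × ℝ => weight a b z.1 z.2 := contDiff_weight a b (n := 1)
  have hφ0' : ∀ y s, 0 ≤ s → R < |(s - |y|)| → ε * freeWave f g (y, s) = 0 := fun y s hs h => by
    rw [hφ0 y s hs h, mul_zero]
  have hBv : ∀ v : ℝ × ℝ → ℝ, (∀ z ∈ Ω, |v z| ≤ B z) →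
      (∀ y, ∀ s ∈ Icc 0 T, |v (y, s)| ≤ D) ∧
      (∀ y, ∀ s ∈ Icc 0 T, s + R < |y| → v (y, s) = 0) := by
    refine fun v hv => ⟨fun y s hs => ?_, fun y s hs h => ?_⟩
    · refine (hv (y, s) hs).trans ?_
      simp only [B]
      split_ifs <;> linarith
    · have := hv (y, s) hs
      simp only [B, if_pos h] at this
      exact abs_nonpos_iff.1 this
  obtain ⟨v, h, hh, hh1, hvh, hvB⟩ := exists_truncated_solution hp (Ω := Ω) (B := B) hw
    (hW2.of_le (by norm_num)) χ.contDiff χ.hasCompactSupport θ.contDiff θ.hasCompactSupport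
    (fun z _ => by simp only [B]; split_ifs <;> linarith)
    (by
      rintro v hvc hvB ⟨x, t⟩ ht
      obtain ⟨hvD, hv0⟩ := hBv v hvB
      have hsrc : Continuous fun z : ℝ × ℝ => χ z * weight a b z.1 z.2 *
          (θ (ε * freeWave f g z + v z) * |ε * freeWave f g z + v z| ^ p) :=
        (χ.continuous.mul hw.continuous).mul
          ((contDiff_one_cutoff_rpow hp θ.contDiff).continuous.comp (hW2.continuous.add hvc))
      have hle : ∀ y, ∀ s ∈ Icc 0 T, |χ (y, s) * weight a b y s *
          (θ (ε * freeWave f g (y, s) + v (y, s)) * |ε * freeWave f g (y, s) + v (y, s)| ^ p)| ≤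
          weight a b y s * |ε * freeWave f g (y, s) + v (y, s)| ^ p := by
        intro y s _
        have h1 := χ.nonneg (x := (y, s))
        have h2 := θ.nonneg (x := ε * freeWave f g (y, s) + v (y, s))
        have h3 := (weight_pos a b y s).le
        rw [abs_of_nonneg (by positivity)]
        have h4 : χ (y, s) * weight a b y s ≤ weight a b y s :=
          mul_le_of_le_one_left h3 χ.le_one
        exact mul_le_mul h4 (mul_le_of_le_one_left (by positivity) θ.le_one) (by positivity) h3
      simp only [B]
      split_ifs with hx
      · rw [duhamel_eq_zero_outside (R := R) ht (fun y s hs hy => ?_) hx, abs_zero]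
        have e : ε * freeWave f g (y, s) + v (y, s) = 0 := by
          rw [hv0 y s hs hy, hφ0' y s hs.1, add_zero]
          rw [abs_sub_comm]
          exact lt_abs.2 (Or.inl (by linarith))
        simp only [e, abs_zero, Real.zero_rpow hp0, mul_zero]
      · exact (hC _ (fun z => ε * freeWave f g z) v N D T hsrc hN hD (fun y s _ => hφN (y, s))
          (fun y s hs => hφ0' y s hs.1) hvD hv0 hle x t ht).trans hsmall)
  obtain ⟨hvD, hv0⟩ := hBv v hvB
  have hv2 : ContDiff ℝ 2 v := hvh ▸ contDiff_two_duhamel hh1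
  have hC2 := hW2.add hv2
  refine ⟨fun x t => ε * freeWave f g (x, t) + v (x, t), hC2.contDiffOn, ?_, ?_, ?_⟩
  · intro x t ht
    have htT : t ∈ Icc 0 T := ⟨ht.1.le, ht.2.le⟩
    have cx : ContDiff ℝ 2 fun y : ℝ => (y, t) := by fun_prop
    have ct : ContDiff ℝ 2 fun s : ℝ => (x, s) := by fun_prop
    have et : iteratedDeriv 2 (fun s => ε * freeWave f g (x, s) + v (x, s)) t =
        iteratedDeriv 2 (fun s => ε * freeWave f g (x, s)) t + iteratedDeriv 2 (fun s => v (x, s)) t :=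
      iteratedDeriv_fun_add (hW2.comp ct).contDiffAt (hv2.comp ct).contDiffAt
    have ex : iteratedDeriv 2 (fun y => ε * freeWave f g (y, t) + v (y, t)) x =
        iteratedDeriv 2 (fun y => ε * freeWave f g (y, t)) x + iteratedDeriv 2 (fun y => v (y, t)) x :=
      iteratedDeriv_fun_add (hW2.comp cx).contDiffAt (hv2.comp cx).contDiffAt
    rw [et, ex, iteratedDeriv_const_mul_field, iteratedDeriv_const_mul_field, freeWave_wave hf hg]
    have hwave := duhamel_wave hh1 x t
    rw [← hvh, hh] at hwave
    rw [add_sub_add_left_eq_sub, hwave]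
    -- Outside the cone `χ` need not be `1`, but there the solution and both sources vanish.
    rcases lt_or_ge (t + R) |x| with hx | hx
    · have e : ε * freeWave f g (x, t) + v (x, t) = 0 := by
        rw [hv0 x t htT hx, hφ0' x t ht.1.le, add_zero]
        rw [abs_sub_comm]
        exact lt_abs.2 (Or.inl (by linarith))
      simp only [e, abs_zero, Real.zero_rpow hp0, mul_zero]
    · have e₁ : χ (x, t) = 1 := by
        refine χ.one_of_mem_closedBall ?_
        rw [mem_closedBall_zero_iff, Prod.norm_def]
        have : (χ.rIn : ℝ) = T + R + 1 := rfl
        rw [this]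
        refine max_le ?_ ?_
        · rw [Real.norm_eq_abs]; linarith [ht.2]
        · rw [Real.norm_eq_abs, abs_of_pos ht.1]; linarith [ht.2]
      have e₂ : θ (ε * freeWave f g (x, t) + v (x, t)) = 1 := by
        refine θ.one_of_mem_closedBall ?_
        rw [mem_closedBall_zero_iff, Real.norm_eq_abs]
        have : (θ.rIn : ℝ) = N + D + 1 := rfl
        rw [this]
        linarith [abs_add_le (ε * freeWave f g (x, t)) (v (x, t)), hφN (x, t), hvD x t htT]
      rw [e₁, e₂, one_mul, one_mul]
  · intro x
    have : v (x, 0) = 0 := by rw [hvh]; simp [duhamel]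
    simp only [this, freeWave_zero, add_zero]
  · intro x
    have h1 := (hasDerivAt_freeWave_zero hf hg x).const_mul ε
    have h2 : HasDerivAt (fun s => v (x, s)) 0 0 := by
      have := hasDerivAt_duhamel_snd hh1.continuous x 0
      rw [← hvh] at this
      simpa [transport] using this
    simpa using (h1.fun_add h2).hasDerivWithinAt

/-- `D = 2C(εM)^p E` makes the free-wave term exactly `D/2`. The other term is at most `D/2` when `C
D^{p-1} I ≤ 1/2`; inserting `D` turns this into the hypothesis, with `η` the resulting constant. -/
theorem exists_amplitude {p C M η ε E I : ℝ} (hp : 1 < p) (hC : 0 < C) (hM : 0 < M) (hε : 0 < ε)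
    (hE : 0 ≤ E) (hη : η = 1 / (2 * C * (2 * C * M ^ p) ^ (p - 1)))
    (h : ε ^ (p * (p - 1)) * (E ^ (p - 1) * I) ≤ η) :
    ∃ D, 0 ≤ D ∧ C * (D ^ p * I + (ε * M) ^ p * E) ≤ D := by
  have hK : 0 < (2 * C * M ^ p) ^ (p - 1) := by positivity
  refine ⟨2 * C * (ε * M) ^ p * E, by positivity, ?_⟩
  set D := 2 * C * (ε * M) ^ p * E with hD
  have hD0 : 0 ≤ D := by positivity
  have e₁ : D ^ p = D * D ^ (p - 1) := by
    rw [← Real.rpow_one_add' hD0 (by linarith)]; ring_nf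
  have e₂ : D ^ (p - 1) = (2 * C * M ^ p) ^ (p - 1) * (ε ^ (p * (p - 1)) * E ^ (p - 1)) := by
    have : D = 2 * C * M ^ p * (ε ^ p * E) := by
      rw [hD, Real.mul_rpow hε.le hM.le]; ring
    rw [this, Real.mul_rpow (by positivity) (by positivity), Real.mul_rpow (by positivity) hE,
      ← Real.rpow_mul hε.le]
  have e₃ : C * (D ^ (p - 1) * I) ≤ 1 / 2 := by
    calc C * (D ^ (p - 1) * I)
        = C * (2 * C * M ^ p) ^ (p - 1) * (ε ^ (p * (p - 1)) * (E ^ (p - 1) * I)) := by rw [e₂]; ring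
      _ ≤ C * (2 * C * M ^ p) ^ (p - 1) * η := by gcongr
      _ = 1 / 2 := by rw [hη]; field_simp
  have := mul_le_mul_of_nonneg_left e₃ hD0
  rw [e₁]
  have hD2 : C * ((ε * M) ^ p * E) = D / 2 := by rw [hD]; ring
  linarith

end CharWave

/-! ### The lifespan theorem -/

theorem theorem1p3 (p a b R : ℝ) (hp : 1 < p) (hR : 1 < R) (f g : ℝ → ℝ)
    (hf : ContDiff ℝ 2 f) (hg : ContDiff ℝ 1 g)
    (hfR : tsupport f ⊆ {x | |x| ≤ R}) (hgR : tsupport g ⊆ {x | |x| ≤ R})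
    (hg0 : ∫ x, g x = 0) :
    ∃ ε₃ > (0 : ℝ), ∃ c > (0 : ℝ), ∀ ε : ℝ, 0 < ε → ε ≤ ε₃ →
      ∀ T : ℝ, 0 < T → CharWave.BelowLifespanBound p a b c ε T →
        ∃ u : ℝ → ℝ → ℝ, CharWave.IsClassicalSolution p a b ε f g T u ∧
          ∀ v : ℝ → ℝ → ℝ, CharWave.IsClassicalSolution p a b ε f g T v →
            ∀ x : ℝ, ∀ t ∈ Set.Ico 0 T, v x t = u x t := by
  have hR0 : 0 ≤ R := by linarith
  have hcompact : ∀ {k : ℝ → ℝ}, tsupport k ⊆ {x | |x| ≤ R} → HasCompactSupport k := fun hk =>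
    isCompact_Icc.of_isClosed_subset (isClosed_tsupport _)
      (fun x hx => abs_le.1 (hk hx) : _ ⊆ Set.Icc (-R) R)
  have hzero : ∀ {k : ℝ → ℝ}, tsupport k ⊆ {x | |x| ≤ R} → ∀ x, R < |x| → k x = 0 := fun hk x hx =>
    image_eq_zero_of_notMem_tsupport fun h => (hk h).not_gt hx
  obtain ⟨M, hM, hMb⟩ := CharWave.exists_freeWave_bound hf.continuous hg.continuous (hcompact hfR)
    (hcompact hgR)
  obtain ⟨C, hC, hbound⟩ := CharWave.exists_isDuhamelBound p a b R (by linarith) hR0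
  -- The threshold depends only on `C`, `M` and `p`, so `ε₃` and `c` are fixed before `ε` and `T`.
  obtain ⟨ε₃, hε₃, c, hc, hlife⟩ := CharWave.exists_lifespan_small (a := a) (b := b)
    (η := 1 / (2 * C * (2 * C * M ^ p) ^ (p - 1))) hp hR0 (by positivity)
  refine ⟨ε₃, hε₃, c, hc, fun ε hε hle T hT hbelow => ?_⟩
  obtain ⟨D, hD, hsmall⟩ := CharWave.exists_amplitude hp hC hM hε (CharWave.powInt_nonneg hT.le) rfl
    (hlife ε hε hle T hT hbelow)
  obtain ⟨u, hu⟩ := CharWave.exists_classicalSolution (ε := ε) (N := ε * M) hp hR0 hf hg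
    (by positivity) hD hT
    (fun z => by rw [abs_mul, abs_of_pos hε]; exact mul_le_mul_of_nonneg_left (hMb z) hε.le)
    (fun y s hs => CharWave.freeWave_eq_zero (hzero hfR) (hzero hgR) hg0 hs) hbound hsmall
  exact ⟨u, hu, fun v hv x t ht => hu.unique hp hv x t ht⟩
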